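/- **Conventions.** Fields are not assumed commutative. For an automorphism $\psi$ of a field $D$, $D[t,\psi]$ is the skew polynomial ring with $t\,x=\psi(x)\,t$ ($x\in D$), and $D(t,\psi)$ is its skew field of fractions. For a field extension $B/A$, $\mathrm{Aut}(B/A)$ is the group of automorphisms of $B$ that are the identity on $A$; $B/A$ is *Galois* if the elements of $B$ fixed by $\mathrm{Aut}(B/A)$ are those of $A$ (one then writes $\mathrm{Gal}(B/A)$), and *outer* if every inner automorphism of $B$ that is the identity on $A$ is the identity. An element $x\in B$ is *algebraic* over $A$ if the subfield $A(x)$ generated by $A$ and $x$ has finite dimension both as a left and as a right $A$-vector space; $B/A$ is *regular* if every element of $B$ algebraic over $A$ lies in $A$. **Setting.** Let $h/k$ be a field extension and $h_0\subset h_1\subset\cdots$ subfields of $h$ containing $k$ with $h=\bigcup_n h_n$, such that for every $n\in\mathbb N$ the extension $h_n/k$ is outer Galois of finite degree $d_n$ with cyclic Galois group generated by $\sigma_n$, and $\sigma_n|_{h_m}=\sigma_m$ for $m\le n$. Let $\mathbf k\subset Z(k)$ be a commutative field and $\mathbf k(t)\subset L\subset\mathbf k((t))$ with $L/\mathbf k(t)$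 Galois. For $m\ge 1$ let $L_m\subset\mathbf k((t^m))$ be the image of $L$ under $S(t)\mapsto S(t^m)$; it contains $\mathbf k(t^m)$. Let $(a_n)$, $(l_n)$ be sequences of natural numbers, $l_n\geq 1$, such that for all $n$ $$l_n\mid l_{n+1},\qquad d_n\ \Big|\ \tfrac{a_{n+1}l_{n+1}}{l_n}-a_n,\qquad d_n\mid l_na_n .$$ Then $t\mapsto t^{l_{n+1}/l_n}$ defines morphisms $u_n:h_n(t,\sigma_n^{a_n})\to h_{n+1}(t,\sigma_{n+1}^{a_{n+1}})$ that are the inclusion $h_n\subset h_{n+1}$ on coefficients, $t^{l_n}$ is central in $h_n(t,\sigma_n^{a_n})$, and $v_n:L_{l_n}\to L_{l_{n+1}}$, $P(t^{l_n})\mapsto P(t^{l_{n+1}})$, is an isomorphism. Put $$H=\varinjlim_{u_n} h_n(t,\sigma_n^{a_n}),\qquad H_G=\varinjlim_{u_n\otimes v_n} h_n(t,\sigma_n^{a_n})\otimes_{\mathbf k(t^{l_n})}L_{l_n}.$$ The inclusions $h_n\subset h_n(t,\sigma_n^{a_n})$ induce an embedding $\alpha:h\to H$, and the maps $x\mapsto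 x\otimes 1$ induce $H\to H_G$; through them $H$ and $H_G$ are extensions of $h$. Let $t_n\in H$ be the image of $t\in h_n(t,\sigma_n^{a_n})$, and let $\Omega_n\subset H$ be the compositum of $h$ and (the image of) $h_n(t,\sigma_n^{a_n})$. **Proposition 5.** The ring $H_G$ is a field, and there are automorphisms $\psi_n$ of $h$ ($n\in\mathbb N$), of finite order, with $\psi_n|_{\mathbf k}=\mathrm{id}$, $\psi_n^{l_n}=1$ and $\psi_i=\psi_j^{l_j/l_i}$ for $i\le j$ (so that $t^{l_n}$ is central in $h(t,\psi_n)$ and $t\mapsto t^{l_j/l_i}$ defines $h$-morphisms $h(t,\psi_i)\to h(t,\psi_j)$), and $\mathbf k(t^{l_n})$-algebra isomorphisms $f_n:h(t,\psi_n)\to\Omega_n$ such that the following hold. 1. For every $n$, $f_n(x)=\alpha(x)$ for $x\in h$, and $f_n(t)=t_n$. 2. For every $n$, $f_n\otimes 1:h(t,\psi_n)\otimes_{\mathbf k(t^{l_n})}L_{l_n}\to\Omega_n\otimes_{\mathbf k(t^{l_n})}L_{l_n}$ followed by the natural map $\Omega_n\otimes_{\mathbf k(t^{l_n})}L_{l_n}\to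 H_G$ is injective, its image is the compositum in $H_G$ of $h$ and $h_n(t,\sigma_n^{a_n})\otimes_{\mathbf k(t^{l_n})}L_{l_n}$, and it sends $x\otimes1$ to the image of $x$ in $H_G$ for $x\in h$. 3. For every $n$, $h(t,\psi_n)\otimes_{\mathbf k(t^{l_n})}L_{l_n}$ is a field and an outer Galois extension of $h(t,\psi_n)$, and there is a group isomorphism $\omega_n$ from $\mathrm{Gal}(L/\mathbf k(t))$ onto its Galois group, with $\omega_n(g)(x\otimes S(t^{l_n}))=x\otimes (gS)(t^{l_n})$ for $g\in \mathrm{Gal}(L/\mathbf k(t))$, $x\in h(t,\psi_n)$ and $S\in L$. 4. The extensions $H/h$ and $H_G/h$ are regular. 5. The $f_n$ induce an isomorphism $\varinjlim h(t,\psi_n)\cong H$ of extensions of $h$, where the limit is taken along $t\mapsto t^{l_j/l_i}$. -/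

import Mathlib

open scoped nonZeroDivisors LaurentSeries TensorProduct

universe u v

namespace SkewTower

/-! ### Skew polynomial rings and skew fraction fields -/

/-- The ring `D`, on which the monoid of powers of the indeterminate acts through `ψ`. -/
def Twist {D : Type u} [DivisionRing D] (_ψ : RingAut D) : Type u := D

instance {D : Type u} [DivisionRing D] (ψ : RingAut D) : DivisionRing (Twist ψ) :=
  inferInstanceAs (DivisionRing D)

/-- The identity map from `D` to its copy `Twist ψ`. -/
def Twist.of {D : Type u} [DivisionRing D] (ψ : RingAut D) : D ≃+* Twist ψ :=
  RingEquiv.refl D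

/-- `t ^ n` acts on coefficients as `ψ ^ n`. -/
instance {D : Type u} [DivisionRing D] (ψ : RingAut D) :
    MulSemiringAction (Multiplicative ℕ) (Twist ψ) where
  smul n x := Twist.of ψ ((ψ ^ (Multiplicative.toAdd n)) ((Twist.of ψ).symm x))
  one_smul _ := rfl
  mul_smul m n x := by
    change Twist.of ψ ((ψ ^ (Multiplicative.toAdd m + Multiplicative.toAdd n)) _) = _
    rw [pow_add]; rfl
  smul_zero n := map_zero (ψ ^ (Multiplicative.toAdd n))
  smul_add n x y := map_add (ψ ^ (Multiplicative.toAdd n)) ((Twist.of ψ).symm x) _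
  smul_one n := map_one (ψ ^ (Multiplicative.toAdd n))
  smul_mul n x y := map_mul (ψ ^ (Multiplicative.toAdd n)) ((Twist.of ψ).symm x) _

theorem Twist.smul_of {D : Type u} [DivisionRing D] (ψ : RingAut D) (n : ℕ) (a : D) :
    Multiplicative.ofAdd n • Twist.of ψ a = Twist.of ψ ((ψ ^ n) a) := rfl

/-- The skew polynomial ring `D[t, ψ]`, with `t a = ψ(a) t`. -/
abbrev SkewPoly {D : Type u} [DivisionRing D] (ψ : RingAut D) : Type u :=
  SkewPolynomial (Twist ψ)

section Poly

variable {D : Type u} [DivisionRing D] {ψ : RingAut D}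

theorem coeff_ext {p q : SkewPoly ψ} (h : ∀ n, p.coeff n = q.coeff n) : p = q :=
  SkewMonoidAlgebra.ext fun a => h (Multiplicative.toAdd a)

theorem coeff_mul (p q : SkewPoly ψ) (n : ℕ) : (p * q).coeff n =
    ∑ x ∈ Finset.HasAntidiagonal.antidiagonal n, p.coeff x.1 * (Multiplicative.ofAdd x.1 • q.coeff x.2) := by
  have := SkewMonoidAlgebra.coeff_mul_antidiagonal_of_finset p q (Multiplicative.ofAdd n)
    ((Finset.HasAntidiagonal.antidiagonal n).map
      ⟨fun x => (Multiplicative.ofAdd x.1, Multiplicative.ofAdd x.2), fun x y h => by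
        simpa [Prod.ext_iff] using h⟩) (by
      rintro ⟨a, b⟩
      simp only [Finset.mem_map, Finset.HasAntidiagonal.mem_antidiagonal, Prod.exists]
      constructor
      · rintro ⟨i, j, h, rfl, rfl⟩
        exact congrArg Multiplicative.ofAdd h
      · intro h
        exact ⟨Multiplicative.toAdd a, Multiplicative.toAdd b, h, rfl⟩)
  refine this.trans ?_
  rw [Finset.sum_map]
  rfl

theorem exists_bound (p : SkewPoly ψ) : ∃ N, ∀ n, N ≤ n → p.coeff n = 0 := by
  refine ⟨p.support.sup id + 1, fun n hn => ?_⟩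
  by_contra h
  have := Finset.le_sup (f := id) (SkewPolynomial.mem_support_iff.2 h)
  simp only [id] at this
  omega

/-- `n` is the degree of `p`. -/
def IsDeg (p : SkewPoly ψ) (n : ℕ) : Prop := p.coeff n ≠ 0 ∧ ∀ m, n < m → p.coeff m = 0

theorem exists_isDeg {p : SkewPoly ψ} (hp : p ≠ 0) : ∃ n, IsDeg p n := by
  classical
  obtain ⟨N, hN⟩ := exists_bound p
  have hne : p.support.Nonempty := by
    rw [Finset.nonempty_iff_ne_empty]
    exact fun h => hp (SkewPolynomial.support_eq_empty.1 h)
  refine ⟨p.support.max' hne, SkewPolynomial.mem_support_iff.1 (Finset.max'_mem _ _), ?_⟩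
  intro m hm
  by_contra h
  have := Finset.le_max' p.support m (SkewPolynomial.mem_support_iff.2 h)
  omega

theorem IsDeg.coeff_mul {p q : SkewPoly ψ} {m n : ℕ} (hp : IsDeg p m) (hq : IsDeg q n) :
    (p * q).coeff (m + n) = p.coeff m * (Multiplicative.ofAdd m • q.coeff n) := by
  rw [SkewTower.coeff_mul, Finset.sum_eq_single (m, n)]
  · rintro ⟨i, j⟩ hij hne
    rw [Finset.HasAntidiagonal.mem_antidiagonal] at hij
    simp only at hij ⊢
    rcases lt_trichotomy m i with h | h | h
    · rw [hp.2 i h, zero_mul]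
    · exact absurd (by simp only [Prod.mk.injEq]; omega) hne
    · rw [hq.2 j (by omega), smul_zero, mul_zero]
  · intro h
    exact absurd (by simp) h

theorem smul_ne_zero_of {x : Twist ψ} (hx : x ≠ 0) (n : Multiplicative ℕ) : n • x ≠ 0 := by
  intro h
  have h' : (ψ ^ (Multiplicative.toAdd n)) ((Twist.of ψ).symm x) = 0 := h
  exact hx ((map_eq_zero_iff _ (Twist.of ψ).symm.injective).1
    ((map_eq_zero_iff _ (RingEquiv.injective (ψ ^ (Multiplicative.toAdd n)))).1 h'))

theorem IsDeg.mul {p q : SkewPoly ψ} {m n : ℕ} (hp : IsDeg p m) (hq : IsDeg q n) :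
    IsDeg (p * q) (m + n) := by
  refine ⟨?_, fun k hk => ?_⟩
  · rw [hp.coeff_mul hq]
    exact mul_ne_zero hp.1 (smul_ne_zero_of hq.1 _)
  · rw [SkewTower.coeff_mul]
    refine Finset.sum_eq_zero ?_
    rintro ⟨i, j⟩ hij
    rw [Finset.HasAntidiagonal.mem_antidiagonal] at hij
    simp only at hij ⊢
    by_cases h : m < i
    · rw [hp.2 i h, zero_mul]
    · rw [hq.2 j (by omega), smul_zero, mul_zero]

instance : NoZeroDivisors (SkewPoly ψ) where
  eq_zero_or_eq_zero_of_mul_eq_zero {p q} h := by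
    by_contra hne
    push Not at hne
    obtain ⟨m, hm⟩ := exists_isDeg hne.1
    obtain ⟨n, hn⟩ := exists_isDeg hne.2
    apply (hm.mul hn).1
    rw [h]
    rfl

/-- Euclidean division on the left by `s`. -/
theorem exists_div (s : SkewPoly ψ) {n : ℕ} (hs : IsDeg s n) (N : ℕ) :
    ∀ r : SkewPoly ψ, (∀ m, N ≤ m → r.coeff m = 0) →
      ∃ q r' : SkewPoly ψ, r = q * s + r' ∧ ∀ m, n ≤ m → r'.coeff m = 0 := by
  induction N with
  | zero =>
    intro r hr
    exact ⟨0, r, by simp, fun m _ => hr m (Nat.zero_le _)⟩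
  | succ N ih =>
    intro r hr
    by_cases hn : n ≤ N
    · by_cases h0 : r.coeff N = 0
      · refine ih r fun m hm => ?_
        rcases hm.eq_or_lt with rfl | h
        · exact h0
        · exact hr m h
      · have hc : Multiplicative.ofAdd (N - n) • s.coeff n ≠ 0 := smul_ne_zero_of hs.1 _
        set c : Twist ψ := r.coeff N * (Multiplicative.ofAdd (N - n) • s.coeff n)⁻¹ with hcdef
        have hc0 : c ≠ 0 := mul_ne_zero h0 (inv_ne_zero hc)
        have hdeg : IsDeg (SkewPolynomial.monomial (N - n) c : SkewPoly ψ) (N - n) := by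
          refine ⟨by simpa [SkewPolynomial.coeff_monomial] using hc0, fun m hm => ?_⟩
          rw [SkewPolynomial.coeff_monomial, if_neg (by omega)]
        have hmul := hdeg.mul hs
        have hlead := hdeg.coeff_mul hs
        rw [Nat.sub_add_cancel hn] at hmul hlead
        rw [SkewPolynomial.coeff_monomial, if_pos rfl, hcdef, mul_assoc, inv_mul_cancel₀ hc,
          mul_one] at hlead
        obtain ⟨q, r', h1, h2⟩ := ih (r - SkewPolynomial.monomial (N - n) c * s) (fun m hm => by
          rw [SkewPolynomial.coeff_sub]
          rcases hm.eq_or_lt with rfl | h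
          · rw [hlead, sub_self]
          · rw [hr m h, hmul.2 m h, sub_zero])
        refine ⟨q + SkewPolynomial.monomial (N - n) c, r', ?_, h2⟩
        rw [add_mul, add_right_comm, ← h1, sub_add_cancel]
    · exact ⟨0, r, by simp, fun m hm => hr m (by omega)⟩

theorem exists_ore (n : ℕ) : ∀ r s : SkewPoly ψ, s ≠ 0 → (∀ m, n ≤ m → s.coeff m = 0) →
    ∃ r' s' : SkewPoly ψ, s' ≠ 0 ∧ s' * r = r' * s := by
  induction n with
  | zero =>
    intro r s hs h
    exact absurd (coeff_ext fun m => h m (Nat.zero_le m)) hs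
  | succ n ih =>
    intro r s hs h
    obtain ⟨d, hd⟩ := exists_isDeg hs
    have hdn : d ≤ n := by
      by_contra hlt
      exact hd.1 (h d (by omega))
    obtain ⟨N, hN⟩ := exists_bound r
    obtain ⟨q, r1, h1, h2⟩ := exists_div s hd N r hN
    by_cases hr1 : r1 = 0
    · exact ⟨q, 1, one_ne_zero, by rw [one_mul, h1, hr1, add_zero]⟩
    · obtain ⟨a, b, hb, hab⟩ := ih s r1 hr1 (fun m hm => h2 m (hdn.trans hm))
      refine ⟨a * q + b, a, ?_, ?_⟩
      · rintro rfl
        rw [zero_mul] at hab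
        exact (mul_ne_zero hb hs) hab
      · rw [add_mul, hab, h1, mul_add, mul_assoc]

/-- The left Ore condition. -/
noncomputable instance : OreLocalization.OreSet (SkewPoly ψ)⁰ :=
  Classical.choice (OreLocalization.nonempty_oreSet_iff_of_noZeroDivisors.2 fun r s => by
    obtain ⟨N, hN⟩ := exists_bound (s : SkewPoly ψ)
    obtain ⟨r', s', hs', h⟩ := exists_ore N r s (nonZeroDivisors.coe_ne_zero s) hN
    exact ⟨r', ⟨s', mem_nonZeroDivisors_of_ne_zero hs'⟩, h⟩)

end Poly

/-- The skew fraction field `D(t, ψ)`: the (left) field of fractions of `D[t, ψ]`. -/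
def SkewFrac {D : Type u} [DivisionRing D] (ψ : RingAut D) : Type u :=
  OreLocalization (SkewPoly ψ)⁰ (SkewPoly ψ)

noncomputable instance {D : Type u} [DivisionRing D] (ψ : RingAut D) :
    DivisionRing (SkewFrac ψ) :=
  inferInstanceAs (DivisionRing (OreLocalization (SkewPoly ψ)⁰ (SkewPoly ψ)))

namespace SkewFrac

section

variable {D : Type u} [DivisionRing D] (ψ : RingAut D)

/-- The inclusion `D[t, ψ] → D(t, ψ)`. -/
noncomputable def ofPoly : SkewPoly ψ →+* SkewFrac ψ :=
  OreLocalization.numeratorRingHom (S := (SkewPoly ψ)⁰)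

/-- The inclusion `D → D(t, ψ)`. -/
noncomputable def C : D →+* SkewFrac ψ :=
  (ofPoly ψ).comp ((SkewPolynomial.CRingHom (R := Twist ψ)).comp (Twist.of ψ : D →+* Twist ψ))

/-- The indeterminate `t` of `D(t, ψ)`. -/
noncomputable def X : SkewFrac ψ := ofPoly ψ (SkewPolynomial.X (R := Twist ψ))

theorem ofPoly_injective : Function.Injective (ofPoly ψ) :=
  OreLocalization.numeratorHom_inj (R := SkewPoly ψ) (S := (SkewPoly ψ)⁰) inf_le_left

theorem X_mul_C (a : D) : X ψ * C ψ a = C ψ (ψ a) * X ψ := by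
  change ofPoly ψ SkewPolynomial.X * ofPoly ψ (SkewPolynomial.C (Twist.of ψ a)) =
    ofPoly ψ (SkewPolynomial.C (Twist.of ψ (ψ a))) * ofPoly ψ SkewPolynomial.X
  rw [← map_mul, ← map_mul, SkewPolynomial.X, SkewPolynomial.monomial_mul_C,
    SkewPolynomial.C_mul_monomial, one_mul, mul_one, SkewPolynomial.φ_iterate_apply,
    Twist.smul_of, pow_one]

theorem X_pow_mul_C (n : ℕ) (a : D) : X ψ ^ n * C ψ a = C ψ ((ψ ^ n) a) * X ψ ^ n := by
  induction n generalizing a with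
  | zero => simp
  | succ n ih =>
    rw [pow_succ, mul_assoc, X_mul_C, ← mul_assoc, ih, mul_assoc, pow_succ ψ]
    rfl

/-- The powers of `t` are left linearly independent over `D`. -/
theorem coeff_eq_zero (q : ℕ) (hq : 0 < q) (s : Finset ℕ) (c : ℕ → D)
    (h : ∑ n ∈ s, C ψ (c n) * X ψ ^ (q * n) = 0) (m : ℕ) (hm : m ∈ s) : c m = 0 := by
  classical
  have key : ∑ n ∈ s, C ψ (c n) * X ψ ^ (q * n) =
      ofPoly ψ (∑ n ∈ s, SkewPolynomial.monomial (q * n) (Twist.of ψ (c n))) := by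
    rw [map_sum]
    refine Finset.sum_congr rfl fun n _ => ?_
    change ofPoly ψ (SkewPolynomial.C (Twist.of ψ (c n))) *
      ofPoly ψ SkewPolynomial.X ^ (q * n) = _
    rw [← map_pow, ← map_mul, SkewPolynomial.X_pow_eq_monomial, SkewPolynomial.C_mul_monomial,
      mul_one]
  rw [key] at h
  have h' := ofPoly_injective ψ (h.trans (map_zero _).symm)
  have hsum : ∀ s : Finset ℕ, (∑ n ∈ s, SkewPolynomial.monomial (q * n)
      (Twist.of ψ (c n)) : SkewPoly ψ).coeff (q * m) =
      ∑ n ∈ s, if n = m then Twist.of ψ (c n) else 0 := by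
    intro s
    induction s using Finset.induction_on with
    | empty => rfl
    | insert a s ha ih =>
      rw [Finset.sum_insert ha, Finset.sum_insert ha, SkewPolynomial.coeff_add, ih,
        SkewPolynomial.coeff_monomial]
      simp [hq.ne']
  have hc := hsum s
  rw [h', Finset.sum_ite_eq', if_pos hm] at hc
  exact (map_eq_zero_iff _ (Twist.of ψ).injective).1 hc.symm

end

section Lift

variable {D : Type u} [DivisionRing D] {ψ : RingAut D} {T : Type v} [DivisionRing T]

/-- Substitution `∑ aᵢ tⁱ ↦ ∑ g(aᵢ) xⁱ`. -/
noncomputable def evalPoly (g : D →+* T) (x : T) (hx : ∀ a, x * g a = g (ψ a) * x) :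
    SkewPoly ψ →+* T :=
  SkewMonoidAlgebra.liftNCRingHom (k := Twist ψ) (g.comp ((Twist.of ψ).symm : Twist ψ →+* D))
    (powersHom T x) (by
      intro a y
      change g ((ψ ^ (Multiplicative.toAdd y)) ((Twist.of ψ).symm a)) *
        x ^ (Multiplicative.toAdd y) = x ^ (Multiplicative.toAdd y) * g ((Twist.of ψ).symm a)
      generalize Multiplicative.toAdd y = n
      generalize (Twist.of ψ).symm a = b
      induction n generalizing b with
      | zero => rw [pow_zero, pow_zero, one_mul, mul_one]; rfl
      | succ n ih =>
        rw [pow_succ x, mul_assoc (x ^ n), hx, ← mul_assoc (x ^ n), ← ih (ψ b), ← mul_assoc,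
          pow_succ ψ]
        rfl)

theorem evalPoly_monomial (g : D →+* T) (x : T) (hx : ∀ a, x * g a = g (ψ a) * x) (n : ℕ) (a : D) :
    evalPoly g x hx (SkewPolynomial.monomial n (Twist.of ψ a)) = g a * x ^ n :=
  SkewMonoidAlgebra.liftNC_single _ _ _ _

theorem evalPoly_apply (g : D →+* T) (x : T) (hx : ∀ a, x * g a = g (ψ a) * x) (p : SkewPoly ψ) :
    evalPoly g x hx p = ∑ n ∈ p.support, g ((Twist.of ψ).symm (p.coeff n)) * x ^ n := by
  conv_lhs => rw [← SkewPolynomial.sum_monomial p, SkewPolynomial.sum_def, map_sum]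
  exact Finset.sum_congr rfl fun n _ => evalPoly_monomial g x hx n ((Twist.of ψ).symm _)

/-- The extension of an injective substitution morphism to the field of fractions. -/
noncomputable def lift (g : D →+* T) (x : T) (hx : ∀ a, x * g a = g (ψ a) * x)
    (hinj : Function.Injective (evalPoly g x hx)) : SkewFrac ψ →+* T :=
  OreLocalization.universalHom (evalPoly g x hx)
    (Units.liftRight ((evalPoly g x hx : SkewPoly ψ →* T).comp (SkewPoly ψ)⁰.subtype)
      (fun s => Units.mk0 (evalPoly g x hx s)
        ((map_ne_zero_iff _ hinj).2 (nonZeroDivisors.coe_ne_zero s))) (fun _ => rfl))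
    (fun _ => rfl)

theorem lift_ofPoly (g : D →+* T) (x : T) (hx : ∀ a, x * g a = g (ψ a) * x)
    (hinj : Function.Injective (evalPoly g x hx)) (p : SkewPoly ψ) :
    lift g x hx hinj (ofPoly ψ p) = evalPoly g x hx p :=
  OreLocalization.universalHom_commutes _ _ _

@[simp]
theorem lift_C (g : D →+* T) (x : T) (hx : ∀ a, x * g a = g (ψ a) * x)
    (hinj : Function.Injective (evalPoly g x hx)) (a : D) : lift g x hx hinj (C ψ a) = g a := by
  refine (lift_ofPoly g x hx hinj _).trans ?_
  have := evalPoly_monomial g x hx 0 a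
  rwa [pow_zero, mul_one] at this

@[simp]
theorem lift_X (g : D →+* T) (x : T) (hx : ∀ a, x * g a = g (ψ a) * x)
    (hinj : Function.Injective (evalPoly g x hx)) : lift g x hx hinj (X ψ) = x := by
  refine (lift_ofPoly g x hx hinj _).trans ?_
  have := evalPoly_monomial g x hx 1 1
  rwa [pow_one, map_one (Twist.of ψ), map_one g, one_mul] at this

/-- Morphisms from `D(t, ψ)` are determined on `D` and `t`. -/
theorem hom_ext {f g : SkewFrac ψ →+* T} (hC : ∀ a, f (C ψ a) = g (C ψ a))
    (hX : f (X ψ) = g (X ψ)) : f = g := by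
  have hpoly : ∀ p, f (ofPoly ψ p) = g (ofPoly ψ p) := by
    intro p
    rw [← SkewPolynomial.sum_monomial p, SkewPolynomial.sum_def, map_sum, map_sum, map_sum]
    refine Finset.sum_congr rfl fun n _ => ?_
    have : (SkewPolynomial.monomial n (p.coeff n) : SkewPoly ψ) =
        SkewPolynomial.CRingHom (R := Twist ψ) (p.coeff n) * SkewPolynomial.X ^ n := by
      rw [SkewPolynomial.X_pow_eq_monomial, SkewPolynomial.CRingHom_eq_C,
        SkewPolynomial.C_mul_monomial, mul_one]
    rw [this, map_mul, map_mul, map_mul, map_pow, map_pow, map_pow]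
    have h1 : f (ofPoly ψ (SkewPolynomial.CRingHom (p.coeff n))) =
        g (ofPoly ψ (SkewPolynomial.CRingHom (p.coeff n))) := hC ((Twist.of ψ).symm (p.coeff n))
    have h2 : f (ofPoly ψ SkewPolynomial.X) = g (ofPoly ψ SkewPolynomial.X) := hX
    rw [h1, h2]
  ext x
  induction x using OreLocalization.ind with | _ r s
  have hs : ofPoly ψ (s : SkewPoly ψ) ≠ 0 :=
    (map_ne_zero_iff _ (ofPoly_injective ψ)).2 (nonZeroDivisors.coe_ne_zero s)
  have hx : ofPoly ψ (s : SkewPoly ψ) * (show SkewFrac ψ from r /ₒ s) = ofPoly ψ r :=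
    OreLocalization.mul_cancel (S := (SkewPoly ψ)⁰)
  have h1 := congrArg f hx
  have h2 := congrArg g hx
  rw [map_mul, hpoly] at h1
  rw [map_mul, ← hpoly r, ← h1] at h2
  exact (mul_left_cancel₀ ((map_ne_zero g).2 hs) h2).symm

end Lift

section Map

variable {D : Type u} [DivisionRing D] {E : Type v} [DivisionRing E]
  {ψ : RingAut D} {ψ' : RingAut E}

theorem map_aux (φ : D →+* E) (q : ℕ) (hφ : ∀ x, φ (ψ x) = (ψ' ^ q) (φ x)) (a : D) :
    X ψ' ^ q * (C ψ').comp φ a = (C ψ').comp φ (ψ a) * X ψ' ^ q := by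
  rw [RingHom.comp_apply, RingHom.comp_apply, X_pow_mul_C, hφ]

theorem map_injective (φ : D →+* E) (q : ℕ) (hq : 0 < q)
    (hφ : ∀ x, φ (ψ x) = (ψ' ^ q) (φ x)) :
    Function.Injective (evalPoly ((C ψ').comp φ) (X ψ' ^ q) (map_aux φ q hφ)) := by
  rw [injective_iff_map_eq_zero]
  intro p hp
  rw [evalPoly_apply] at hp
  simp only [← pow_mul, RingHom.comp_apply] at hp
  refine coeff_ext fun m => ?_
  by_contra hm
  change p.coeff m ≠ 0 at hm
  have h0 := coeff_eq_zero ψ' q hq p.support (fun n => φ ((Twist.of ψ).symm (p.coeff n))) hp m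
    (SkewPolynomial.mem_support_iff.2 hm)
  exact hm ((map_eq_zero_iff _ (Twist.of ψ).symm.injective).1 ((map_eq_zero φ).1 h0))

/-- The morphism `D(t, ψ) → E(t, ψ')` that is `φ` on coefficients and sends `t` to `t ^ q`. -/
noncomputable def map (φ : D →+* E) (q : ℕ) (hq : 0 < q)
    (hφ : ∀ x, φ (ψ x) = (ψ' ^ q) (φ x)) : SkewFrac ψ →+* SkewFrac ψ' :=
  lift ((C ψ').comp φ) (X ψ' ^ q) (map_aux φ q hφ) (map_injective φ q hq hφ)

@[simp]
theorem map_C (φ : D →+* E) (q : ℕ) (hq : 0 < q)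
    (hφ : ∀ x, φ (ψ x) = (ψ' ^ q) (φ x)) (a : D) : map φ q hq hφ (C ψ a) = C ψ' (φ a) :=
  lift_C _ _ _ _ a

@[simp]
theorem map_X (φ : D →+* E) (q : ℕ) (hq : 0 < q)
    (hφ : ∀ x, φ (ψ x) = (ψ' ^ q) (φ x)) : map φ q hq hφ (X ψ) = X ψ' ^ q :=
  lift_X _ _ _ _

end Map

end SkewFrac

/-! ### Extensions of (skew) fields -/

/-- A ring that is a (skew) field. -/
def IsSkewField (A : Type*) [Ring A] : Prop :=
  Nontrivial A ∧ ∀ a : A, a ≠ 0 → IsUnit a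

section Extensions

variable {R : Type*} {A : Type*} [Ring R] [Ring A]

/-- The (skew) subfield generated by a set: the smallest subring that contains the set and is
closed under inversion. -/
def fieldClosure (s : Set A) : Subring A :=
  sInf {T : Subring A | s ⊆ T ∧ ∀ x ∈ T, ∀ y, x * y = 1 → y * x = 1 → y ∈ T}

/-- `Aut(A / R)` for the extension `f : R → A`. -/
def extAut (f : R →+* A) : Subgroup (RingAut A) where
  carrier := {g | ∀ r, g (f r) = f r}
  one_mem' _ := rfl
  mul_mem' {g g'} hg hg' r := by
    change g (g' (f r)) = f r
    rw [hg' r, hg r]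
  inv_mem' {g} hg r := by
    change g.symm (f r) = f r
    rw [RingEquiv.symm_apply_eq, hg r]

/-- The extension is Galois: the elements fixed by `Aut(A / R)` are those of the base field. -/
def IsGaloisExt (f : R →+* A) : Prop :=
  ∀ x, (∀ g ∈ extAut f, g x = x) → x ∈ f.range

/-- The extension is outer: an inner automorphism that is trivial on the base is the identity. -/
def IsOuterExt (f : R →+* A) : Prop :=
  ∀ c : Aˣ, (∀ r, (c : A) * f r * (c⁻¹ : Aˣ) = f r) → ∀ x, (c : A) * x * (c⁻¹ : Aˣ) = x

/-- An outer Galois extension. -/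
def IsOuterGalois (f : R →+* A) : Prop := IsGaloisExt f ∧ IsOuterExt f

/-- `x` is algebraic over the base: the subfield `R(x)` generated by `x` over the base has finite
dimension as a left and as a right vector space over the base. -/
def IsAlgebraicOver (f : R →+* A) (x : A) : Prop :=
  (∃ b : Finset A, ∀ y ∈ fieldClosure (Set.range f ∪ {x}), ∃ c : A → R, y = ∑ e ∈ b, f (c e) * e) ∧
  (∃ b : Finset A, ∀ y ∈ fieldClosure (Set.range f ∪ {x}), ∃ c : A → R, y = ∑ e ∈ b, e * f (c e))

/-- The extension is regular: every element algebraic over the base lies in the base. -/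
def IsRegularExt (f : R →+* A) : Prop :=
  ∀ x, IsAlgebraicOver f x → x ∈ f.range

end Extensions

/-! ### Laurent series in a power of the indeterminate -/

section Laurent

variable {F : Type v} [Field F]

/-- The inclusion `F(t) → F((t))`. -/
noncomputable instance : Algebra (RatFunc F) F⸨X⸩ := RatFunc.liftAlgebra F F⸨X⸩

/-- The substitution `S(t) ↦ S(t ^ m)` on Laurent series. -/
noncomputable def powSubst (m : ℕ) (hm : 0 < m) : F⸨X⸩ →+* F⸨X⸩ :=
  HahnSeries.embDomainRingHom (AddMonoidHom.mulLeft (m : ℤ))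
    (fun a b h => by
      have hm' : (m : ℤ) ≠ 0 := by exact_mod_cast hm.ne'
      exact mul_left_cancel₀ hm' h)
    (fun a b => by
      have hm' : (0 : ℤ) < m := by exact_mod_cast hm
      exact mul_le_mul_iff_right₀ hm')

theorem powSubst_comp (m n k : ℕ) (hm : 0 < m) (hn : 0 < n) (hk : 0 < k) (h : k = n * m)
    (x : F⸨X⸩) : powSubst n hn (powSubst m hm x) = powSubst k hk x := by
  subst h
  ext i
  have hmul : ∀ (q : ℕ) (hq : 0 < q) (y : F⸨X⸩) (j : ℤ),
      (powSubst q hq y).coeff (q * j) = y.coeff j := fun q hq y j =>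
    HahnSeries.embDomain_coeff (f := ⟨⟨_, _⟩, _⟩) (a := j)
  have hnot : ∀ (q : ℕ) (hq : 0 < q) (y : F⸨X⸩) (j : ℤ), ¬ (q : ℤ) ∣ j →
      (powSubst q hq y).coeff j = 0 := fun q hq y j hj =>
    HahnSeries.embDomain_of_notMem_range (f := ⟨⟨_, _⟩, _⟩) (by
      rintro ⟨a, rfl⟩
      exact hj ⟨a, rfl⟩)
  by_cases h1 : (n : ℤ) ∣ i
  · obtain ⟨j, rfl⟩ := h1
    rw [hmul]
    by_cases h2 : (m : ℤ) ∣ j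
    · obtain ⟨a, rfl⟩ := h2
      rw [hmul]
      have := hmul (n * m) hk x a
      push_cast at this
      rw [← mul_assoc, this]
    · rw [hnot m hm x j h2, hnot (n * m) hk x]
      push_cast
      rintro ⟨a, ha⟩
      apply h2
      have hn' : (n : ℤ) ≠ 0 := by exact_mod_cast hn.ne'
      exact ⟨a, mul_left_cancel₀ hn' (by rw [ha, mul_assoc])⟩
  · rw [hnot n hn _ i h1, hnot (n * m) hk x]
    push_cast
    exact fun h => h1 ((Dvd.intro _ rfl).trans h)

variable (L : IntermediateField (RatFunc F) F⸨X⸩)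

/-- `L_m ⊆ F((t ^ m))`: the image of `F(t) ⊆ L ⊆ F((t))` under `S(t) ↦ S(t ^ m)`. -/
noncomputable def LPow (m : ℕ) (hm : 0 < m) : Subfield F⸨X⸩ :=
  L.toSubfield.map (powSubst m hm)

/-- The isomorphism `L → L_m`, `S(t) ↦ S(t ^ m)`. -/
noncomputable def toLPow (m : ℕ) (hm : 0 < m) : L →+* LPow L m hm :=
  ((powSubst m hm).comp L.val.toRingHom).codRestrict (LPow L m hm)
    (fun x => ⟨x, x.2, rfl⟩)

/-- `F(t ^ m)`, identified with `F(X)` through `X ↦ t ^ m`, acts on `L_m`. -/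
noncomputable instance (m : ℕ) (hm : 0 < m) : Algebra (RatFunc F) (LPow L m hm) :=
  ((toLPow L m hm).comp (algebraMap (RatFunc F) L)).toAlgebra

theorem coe_algebraMap_LPow (m : ℕ) (hm : 0 < m) (r : RatFunc F) :
    (algebraMap (RatFunc F) (LPow L m hm) r : F⸨X⸩) =
      powSubst m hm (algebraMap (RatFunc F) F⸨X⸩ r) := rfl

/-- The morphism `L_m → L_n`, `P(t ^ m) ↦ P(t ^ n)`, for `m ∣ n`. -/
noncomputable def LPow.trans {m n : ℕ} (hm : 0 < m) (hn : 0 < n) (h : m ∣ n) :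
    LPow L m hm →ₐ[RatFunc F] LPow L n hn where
  __ := ((powSubst (n / m) (Nat.div_pos (Nat.le_of_dvd hn h) hm)).comp
      (LPow L m hm).subtype).codRestrict (LPow L n hn) (by
        rintro ⟨x, y, hy, rfl⟩
        exact ⟨y, hy, (powSubst_comp m (n / m) n hm (Nat.div_pos (Nat.le_of_dvd hn h) hm) hn
          (Nat.div_mul_cancel h).symm y).symm⟩)
  commutes' r := by
    apply Subtype.ext
    exact powSubst_comp m (n / m) n hm (Nat.div_pos (Nat.le_of_dvd hn h) hm) hn
      (Nat.div_mul_cancel h).symm _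

theorem LPow.coe_trans {m n : ℕ} (hm : 0 < m) (hn : 0 < n) (h : m ∣ n) (x : LPow L m hm) :
    (LPow.trans L hm hn h x : F⸨X⸩) =
      powSubst (n / m) (Nat.div_pos (Nat.le_of_dvd hn h) hm) x := rfl

theorem LPow.trans_toLPow {m n : ℕ} (hm : 0 < m) (hn : 0 < n) (h : m ∣ n) (y : L) :
    LPow.trans L hm hn h (toLPow L m hm y) = toLPow L n hn y :=
  Subtype.ext (powSubst_comp m (n / m) n hm (Nat.div_pos (Nat.le_of_dvd hn h) hm) hn
    (Nat.div_mul_cancel h).symm _)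

theorem toLPow_surjective (m : ℕ) (hm : 0 < m) : Function.Surjective (toLPow L m hm) := by
  rintro ⟨x, y, hy, rfl⟩
  exact ⟨⟨y, hy⟩, rfl⟩

end Laurent

/-! ### Directed systems of skew fraction fields -/

/-- A directed system of skew fields `D n` with automorphisms `ψ n`, a commutative field `F`
contained in the centers and fixed by the automorphisms, and integers `l n` such that
`t ↦ t ^ (l j / l i)` induces morphisms `D i (t, ψ i) → D j (t, ψ j)` and `t ^ (l n)` is central in
`D n (t, ψ n)`. -/
structure SkewSystem (F : Type v) [Field F] (D : ℕ → Type u) [∀ n, DivisionRing (D n)] where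
  φ : ∀ i j, i ≤ j → D i →+* D j
  φ_self : ∀ i x, φ i i le_rfl x = x
  φ_comp : ∀ i j k (hij : i ≤ j) (hjk : j ≤ k) (x : D i),
    φ j k hjk (φ i j hij x) = φ i k (hij.trans hjk) x
  ι : ∀ n, F →+* D n
  φ_ι : ∀ i j (hij : i ≤ j) c, φ i j hij (ι i c) = ι j c
  ι_comm : ∀ n c x, ι n c * x = x * ι n c
  ψ : ∀ n, RingAut (D n)
  ψ_ι : ∀ n c, ψ n (ι n c) = ι n c
  l : ℕ → ℕ
  l_pos : ∀ n, 0 < l n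
  l_dvd : ∀ i j, i ≤ j → l i ∣ l j
  ψ_pow : ∀ n, ψ n ^ l n = 1
  φ_ψ : ∀ i j (hij : i ≤ j) (x : D i), φ i j hij (ψ i x) = (ψ j ^ (l j / l i)) (φ i j hij x)

theorem ratFunc_hom_ext {F : Type v} [Field F] {M : Type*} [DivisionRing M]
    {f g : RatFunc F →+* M} (hC : ∀ c, f (RatFunc.C c) = g (RatFunc.C c))
    (hX : f RatFunc.X = g RatFunc.X) : f = g := by
  have h : f.comp (algebraMap (Polynomial F) (RatFunc F)) =
      g.comp (algebraMap (Polynomial F) (RatFunc F)) := by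
    refine Polynomial.ringHom_ext (fun c => ?_) ?_
    · simpa using hC c
    · simpa using hX
  ext x
  induction x using RatFunc.induction_on with
  | f p q hq =>
    have hp := RingHom.congr_fun h p
    have hq := RingHom.congr_fun h q
    simp only [RingHom.comp_apply] at hp hq
    rw [map_div₀, map_div₀, hp, hq]

namespace SkewSystem

variable {F : Type v} [Field F] {D : ℕ → Type u} [∀ n, DivisionRing (D n)] (S : SkewSystem F D)

/-- The field `D n (t, ψ n)`. -/
def M (n : ℕ) : Type u := SkewFrac (S.ψ n)

noncomputable instance (n : ℕ) : DivisionRing (S.M n) :=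
  inferInstanceAs (DivisionRing (SkewFrac (S.ψ n)))

/-- The inclusion `D n → D n (t, ψ n)`. -/
noncomputable def C (n : ℕ) : D n →+* S.M n := SkewFrac.C (S.ψ n)

/-- The indeterminate of `D n (t, ψ n)`. -/
noncomputable def X (n : ℕ) : S.M n := SkewFrac.X (S.ψ n)

variable {S} in
theorem mem_center {n : ℕ} {z : S.M n} (hC : ∀ a, z * S.C n a = S.C n a * z)
    (hX : z * S.X n = S.X n * z) : z ∈ Subring.center (S.M n) := by
  by_cases hz : z = 0
  · rw [hz]; exact zero_mem _
  let f : S.M n →+* S.M n :=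
    { toFun := fun x => z * x * z⁻¹
      map_one' := by rw [mul_one, mul_inv_cancel₀ hz]
      map_zero' := by rw [mul_zero, zero_mul]
      map_add' := fun x y => by rw [mul_add, add_mul]
      map_mul' := fun x y => by
        rw [mul_assoc (z * x) z⁻¹, ← mul_assoc z⁻¹ (z * y), ← mul_assoc z⁻¹ z, inv_mul_cancel₀ hz,
          one_mul, ← mul_assoc, ← mul_assoc] }
  have hf : f = RingHom.id _ := SkewFrac.hom_ext (ψ := S.ψ n)
    (fun a => by
      change z * S.C n a * z⁻¹ = S.C n a
      rw [hC, mul_assoc, mul_inv_cancel₀ hz, mul_one])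
    (by
      change z * S.X n * z⁻¹ = S.X n
      rw [hX, mul_assoc, mul_inv_cancel₀ hz, mul_one])
  rw [Subring.mem_center_iff]
  intro x
  have hx : z * x * z⁻¹ = x := RingHom.congr_fun hf x
  rw [mul_inv_eq_iff_eq_mul₀ hz] at hx
  exact hx.symm

theorem C_ι_mem_center (n : ℕ) (c : F) : S.C n (S.ι n c) ∈ Subring.center (S.M n) := by
  refine mem_center (fun a => ?_) ?_
  · rw [← map_mul, ← map_mul, S.ι_comm]
  · have := SkewFrac.X_mul_C (S.ψ n) (S.ι n c)
    rw [S.ψ_ι] at this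
    exact this.symm

theorem X_pow_mem_center (n : ℕ) : S.X n ^ S.l n ∈ Subring.center (S.M n) := by
  refine mem_center (fun a => ?_) ?_
  · have := SkewFrac.X_pow_mul_C (S.ψ n) (S.l n) a
    rw [S.ψ_pow] at this
    exact this
  · rw [← pow_succ, ← pow_succ']

/-- `F[X] → Z(D n (t, ψ n))`, `P ↦ P(t ^ (l n))`. -/
noncomputable def centralPoly (n : ℕ) : Polynomial F →+* Subring.center (S.M n) :=
  Polynomial.eval₂RingHom (((S.C n).comp (S.ι n)).codRestrict _ (S.C_ι_mem_center n))
    ⟨S.X n ^ S.l n, S.X_pow_mem_center n⟩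

theorem centralPoly_injective (n : ℕ) : Function.Injective (S.centralPoly n) := by
  rw [injective_iff_map_eq_zero]
  intro p hp
  have h1 : ((S.centralPoly n p : Subring.center (S.M n)) : S.M n) = 0 := by rw [hp]; rfl
  have h2 : ((S.centralPoly n p : Subring.center (S.M n)) : S.M n) =
      ∑ i ∈ p.support, S.C n (S.ι n (p.coeff i)) * S.X n ^ (S.l n * i) := by
    unfold centralPoly
    rw [Polynomial.coe_eval₂RingHom, Polynomial.eval₂_eq_sum, Polynomial.sum_def,
      AddSubmonoidClass.coe_finsetSum]
    refine Finset.sum_congr rfl fun i _ => ?_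
    rw [pow_mul]
    rfl
  rw [h2] at h1
  ext m
  by_contra hm
  have := SkewFrac.coeff_eq_zero (S.ψ n) (S.l n) (S.l_pos n) p.support
    (fun i => S.ι n (p.coeff i)) h1 m (Polynomial.mem_support_iff.2 hm)
  exact hm ((map_eq_zero (S.ι n)).1 this)

/-- The embedding `F(X) ≅ F(t ^ (l n)) → D n (t, ψ n)`, `X ↦ t ^ (l n)`. -/
noncomputable def baseHom (n : ℕ) : RatFunc F →+* S.M n :=
  (Subring.center (S.M n)).subtype.comp (RatFunc.liftRingHom (S.centralPoly n)
    (nonZeroDivisors_le_comap_nonZeroDivisors_of_injective _ (S.centralPoly_injective n)))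

/-- `D n (t, ψ n)` is an algebra over `F(t ^ (l n)) ≅ F(X)`. -/
noncomputable instance (n : ℕ) : Algebra (RatFunc F) (S.M n) :=
  (S.baseHom n).toAlgebra' (fun r x => (Subring.mem_center_iff.1
    (RatFunc.liftRingHom (S.centralPoly n) (nonZeroDivisors_le_comap_nonZeroDivisors_of_injective _
      (S.centralPoly_injective n)) r).2 x).symm)

theorem algebraMap_C (n : ℕ) (c : F) :
    algebraMap (RatFunc F) (S.M n) (RatFunc.C c) = S.C n (S.ι n c) := by
  change ((RatFunc.liftRingHom (S.centralPoly n) _ (RatFunc.C c) : Subring.center (S.M n)) :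
    S.M n) = _
  rw [← RatFunc.algebraMap_C, RatFunc.liftRingHom_algebraMap]
  simp [centralPoly]

theorem algebraMap_X (n : ℕ) :
    algebraMap (RatFunc F) (S.M n) RatFunc.X = S.X n ^ S.l n := by
  change ((RatFunc.liftRingHom (S.centralPoly n) _ RatFunc.X : Subring.center (S.M n)) :
    S.M n) = _
  rw [← RatFunc.algebraMap_X, RatFunc.liftRingHom_algebraMap]
  simp [centralPoly]

/-- The transition morphism `D i (t, ψ i) → D j (t, ψ j)`, `P(t) ↦ P(t ^ (l j / l i))`. -/
noncomputable def transHom (i j : ℕ) (hij : i ≤ j) : S.M i →+* S.M j :=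
  SkewFrac.map (ψ := S.ψ i) (ψ' := S.ψ j) (S.φ i j hij) (S.l j / S.l i)
    (Nat.div_pos (Nat.le_of_dvd (S.l_pos j) (S.l_dvd i j hij)) (S.l_pos i)) (S.φ_ψ i j hij)

theorem transHom_C (i j : ℕ) (hij : i ≤ j) (a : D i) :
    S.transHom i j hij (S.C i a) = S.C j (S.φ i j hij a) := SkewFrac.map_C _ _ _ _ a

theorem transHom_X (i j : ℕ) (hij : i ≤ j) :
    S.transHom i j hij (S.X i) = S.X j ^ (S.l j / S.l i) := SkewFrac.map_X _ _ _ _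

/-- The transition morphisms are linear over `F(X)`. -/
noncomputable def trans (i j : ℕ) (hij : i ≤ j) : S.M i →ₐ[RatFunc F] S.M j where
  __ := S.transHom i j hij
  commutes' r := by
    have h : (S.transHom i j hij).comp (algebraMap (RatFunc F) (S.M i)) =
        algebraMap (RatFunc F) (S.M j) := by
      apply ratFunc_hom_ext
      · intro c
        rw [RingHom.comp_apply, algebraMap_C, algebraMap_C, transHom_C, S.φ_ι]
      · rw [RingHom.comp_apply, algebraMap_X, algebraMap_X, map_pow, transHom_X, ← pow_mul,
          Nat.div_mul_cancel (S.l_dvd i j hij)]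
    exact RingHom.congr_fun h r

instance : DirectedSystem S.M (S.trans · · ·) where
  map_self i x := by
    have h : S.transHom i i le_rfl = RingHom.id _ := SkewFrac.hom_ext (ψ := S.ψ i)
      (fun a => by
        change S.transHom i i le_rfl (S.C i a) = S.C i a
        rw [transHom_C, S.φ_self])
      (by
        change S.transHom i i le_rfl (S.X i) = S.X i
        rw [transHom_X, Nat.div_self (S.l_pos i), pow_one])
    exact RingHom.congr_fun h x
  map_map k j i hij hjk x := by
    have h : (S.transHom j k hjk).comp (S.transHom i j hij) = S.transHom i k (hij.trans hjk) :=
      SkewFrac.hom_ext (ψ := S.ψ i)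
      (fun a => by
        change S.transHom j k hjk (S.transHom i j hij (S.C i a)) =
          S.transHom i k (hij.trans hjk) (S.C i a)
        rw [transHom_C, transHom_C, transHom_C, S.φ_comp])
      (by
        change S.transHom j k hjk (S.transHom i j hij (S.X i)) =
          S.transHom i k (hij.trans hjk) (S.X i)
        rw [transHom_X, map_pow, transHom_X, transHom_X, ← pow_mul,
          Nat.div_mul_div_comm (S.l_dvd j k hjk) (S.l_dvd i j hij), mul_comm (S.l k),
          Nat.mul_div_mul_left _ _ (S.l_pos j)])
    exact RingHom.congr_fun h x

/-- The direct limit of the fields `D n (t, ψ n)`. -/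
abbrev Lim : Type u := DirectLimit S.M S.trans

noncomputable instance : DivisionRing S.Lim := inferInstance

noncomputable instance : Algebra (RatFunc F) S.Lim := inferInstance

/-- The canonical morphism `D n (t, ψ n) → lim`. -/
noncomputable def of (n : ℕ) : S.M n →ₐ[RatFunc F] S.Lim where
  __ := DirectLimit.Ring.of S.M S.trans n
  commutes' r := (DirectLimit.algebraMap_def n r).symm

variable (L : IntermediateField (RatFunc F) F⸨X⸩)

/-- The algebra `D n (t, ψ n) ⊗ L_{l n}` over `F(t ^ (l n)) ≅ F(X)`. -/
abbrev Ext (n : ℕ) : Type (max u v) := S.M n ⊗[RatFunc F] LPow L (S.l n) (S.l_pos n)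

/-- The transition morphism `P(t) ⊗ R(t ^ (l i)) ↦ P(t ^ (l j / l i)) ⊗ R(t ^ (l j))`. -/
noncomputable def extTrans (i j : ℕ) (hij : i ≤ j) : S.Ext L i →ₐ[RatFunc F] S.Ext L j :=
  Algebra.TensorProduct.map (S.trans i j hij)
    (LPow.trans L (S.l_pos i) (S.l_pos j) (S.l_dvd i j hij))

instance : DirectedSystem (S.Ext L) (S.extTrans L · · ·) where
  map_self i x := by
    have h : S.extTrans L i i le_rfl = AlgHom.id _ _ := by
      apply Algebra.TensorProduct.ext'
      intro a b
      obtain ⟨y, rfl⟩ := toLPow_surjective L _ _ b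
      simp only [extTrans, Algebra.TensorProduct.map_tmul, AlgHom.id_apply, LPow.trans_toLPow]
      rw [DirectedSystem.map_self' S.trans]
    exact DFunLike.congr_fun h x
  map_map k j i hij hjk x := by
    have h : (S.extTrans L j k hjk).comp (S.extTrans L i j hij) =
        S.extTrans L i k (hij.trans hjk) := by
      apply Algebra.TensorProduct.ext'
      intro a b
      obtain ⟨y, rfl⟩ := toLPow_surjective L _ _ b
      simp only [extTrans, AlgHom.comp_apply, Algebra.TensorProduct.map_tmul, LPow.trans_toLPow]
      rw [DirectedSystem.map_map' S.trans]
    exact DFunLike.congr_fun h x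

/-- The direct limit of the algebras `D n (t, ψ n) ⊗ L_{l n}`. -/
abbrev ExtLim : Type (max u v) := DirectLimit (S.Ext L) (S.extTrans L)

/-- The canonical morphism `D n (t, ψ n) ⊗ L_{l n} → lim`. -/
noncomputable def extOf (n : ℕ) : S.Ext L n →ₐ[RatFunc F] S.ExtLim L where
  __ := DirectLimit.Ring.of (S.Ext L) (S.extTrans L) n
  commutes' r := (DirectLimit.algebraMap_def n r).symm

theorem extOf_trans (i j : ℕ) (hij : i ≤ j) (x : S.Ext L i) :
    S.extOf L j (S.extTrans L i j hij x) = S.extOf L i x :=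
  DirectLimit.Ring.of_f hij x

theorem of_trans (i j : ℕ) (hij : i ≤ j) (x : S.M i) :
    S.of j (S.trans i j hij x) = S.of i x :=
  DirectLimit.Ring.of_f hij x

/-- The morphism `lim D n (t, ψ n) → lim (D n (t, ψ n) ⊗ L_{l n})` induced by `x ↦ x ⊗ 1`. -/
noncomputable def limToExtLim : S.Lim →ₐ[RatFunc F] S.ExtLim L where
  __ := DirectLimit.Ring.lift S.M S.trans (S.ExtLim L)
    (fun n => ((S.extOf L n).comp Algebra.TensorProduct.includeLeft).toRingHom)
    (fun i j hij x => by
      change S.extOf L j (S.trans i j hij x ⊗ₜ 1) = S.extOf L i (x ⊗ₜ 1)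
      rw [← S.extOf_trans L i j hij, extTrans, Algebra.TensorProduct.map_tmul, map_one])
  commutes' r := by
    rw [DirectLimit.algebraMap_def 0 r]
    exact ((S.extOf L 0).comp Algebra.TensorProduct.includeLeft).commutes r

theorem limToExtLim_of (n : ℕ) (x : S.M n) :
    S.limToExtLim L (S.of n x) = S.extOf L n (x ⊗ₜ 1) := rfl

/-- The morphism `L_{l n} → D n (t, ψ n) ⊗ L_{l n} → lim`. -/
noncomputable def LToExtLim (n : ℕ) : LPow L (S.l n) (S.l_pos n) →ₐ[RatFunc F] S.ExtLim L :=
  (S.extOf L n).comp Algebra.TensorProduct.includeRight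

theorem commute_limToExtLim (n : ℕ) (x : S.Lim) (y : LPow L (S.l n) (S.l_pos n)) :
    Commute (S.limToExtLim L x) (S.LToExtLim L n y) := by
  induction x using DirectLimit.induction with | _ m x
  have hx : S.limToExtLim L (S.of m x) = S.extOf L (max m n)
      (S.trans m (max m n) (le_max_left _ _) x ⊗ₜ 1) := by
    rw [← S.of_trans m (max m n) (le_max_left _ _), limToExtLim_of]
  have hy : S.LToExtLim L n y = S.extOf L (max m n)
      (1 ⊗ₜ LPow.trans L (S.l_pos n) (S.l_pos _) (S.l_dvd n (max m n) (le_max_right _ _)) y) := by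
    change S.extOf L n (1 ⊗ₜ y) = _
    rw [← S.extOf_trans L n (max m n) (le_max_right _ _), extTrans,
      Algebra.TensorProduct.map_tmul, map_one]
  change Commute (S.limToExtLim L (S.of m x)) _
  rw [hx, hy]
  exact ((Commute.one_right _).tmul (Commute.one_left _)).map (S.extOf L (max m n))

end SkewSystem

/-! ### The order of a generator of a cyclic Galois group -/

section Artin

variable {E : Type u} [DivisionRing E] {k : Subfield E}

/-- Distinct automorphisms over the base of an outer extension are independent. -/
theorem aut_independent (hout : IsOuterExt k.subtype) (s : Finset (RingAut E)) :
    (∀ g ∈ s, g ∈ extAut k.subtype) → ∀ a : RingAut E → E,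
      (∀ x, ∑ g ∈ s, g x * a g = 0) → ∀ g ∈ s, a g = 0 := by
  classical
  induction s using Finset.induction_on with
  | empty => simp
  | insert j s hj ih =>
    intro hs a ha
    have hs' : ∀ g ∈ s, g ∈ extAut k.subtype := fun g hg => hs g (Finset.mem_insert_of_mem hg)
    have hjaut := hs j (Finset.mem_insert_self j s)
    by_cases haj : a j = 0
    · intro g hg
      rcases Finset.mem_insert.1 hg with rfl | hg
      · exact haj
      · refine ih hs' a (fun x => ?_) g hg
        have := ha x
        rwa [Finset.sum_insert hj, haj, mul_zero, zero_add] at this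
    · exfalso
      set b : RingAut E → E := fun g => a g * (a j)⁻¹ with hb
      have hbj : b j = 1 := mul_inv_cancel₀ haj
      have hb0 : ∀ x, ∑ g ∈ insert j s, g x * b g = 0 := fun x => by
        have : ∑ g ∈ insert j s, g x * b g = (∑ g ∈ insert j s, g x * a g) * (a j)⁻¹ := by
          rw [Finset.sum_mul]
          exact Finset.sum_congr rfl fun g _ => (mul_assoc _ _ _).symm
        rw [this, ha, zero_mul]
      clear_value b
      have hc : ∀ y, ∀ g ∈ s, g y * b g - b g * j y = 0 := by
        intro y
        refine ih hs' (fun g => g y * b g - b g * j y) (fun x => ?_)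
        have h1 := hb0 (x * y)
        have h2 : (∑ g ∈ insert j s, g x * b g) * j y = 0 := by rw [hb0, zero_mul]
        rw [Finset.sum_insert hj, hbj, map_mul] at h1
        rw [Finset.sum_insert hj, hbj, add_mul, mul_one, Finset.sum_mul] at h2
        have h3 : ∑ g ∈ s, g x * (g y * b g - b g * j y) =
            ∑ g ∈ s, g (x * y) * b g - ∑ g ∈ s, g x * b g * j y := by
          rw [← Finset.sum_sub_distrib]
          refine Finset.sum_congr rfl fun g _ => ?_
          rw [map_mul, mul_sub, mul_assoc, mul_assoc (g x) (b g)]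
        rw [h3, eq_neg_of_add_eq_zero_right h1, eq_neg_of_add_eq_zero_right h2, mul_one, sub_self]
      have hbs : ∀ g ∈ s, b g = 0 := by
        intro g hg
        by_contra hne
        have hconj : ∀ y, b g * j y * (b g)⁻¹ = g y := fun y => by
          rw [← sub_eq_zero.1 (hc y g hg), mul_assoc, mul_inv_cancel₀ hne, mul_one]
        have hid := hout (Units.mk0 (b g) hne) (fun r => by
          change b g * (r : E) * (b g)⁻¹ = r
          have h1 := hconj r
          have h2 : j (r : E) = r := hjaut r
          have h3 : g (r : E) = r := hs' g hg r
          rwa [h2, h3] at h1)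
        have : g = j := by
          ext y
          rw [← hconj y]
          exact hid (j y)
        exact hj (this ▸ hg)
      have h1 := hb0 1
      rw [Finset.sum_insert hj, hbj, map_one, Finset.sum_eq_zero (fun g hg => by
        rw [hbs g hg, mul_zero])] at h1
      simp at h1

/-- In an outer Galois extension of finite degree `d`, a generator of the Galois group satisfies
`σ ^ d = 1`. -/
theorem pow_finrank_eq_one (hgal : IsOuterGalois k.subtype) {σ : RingAut E}
    (hσ : ∀ g, g ∈ extAut k.subtype ↔ g ∈ Subgroup.zpowers σ) {d : ℕ} (hd : 0 < d)
    (hdim : Module.finrank k E = d) : σ ^ d = 1 := by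
  classical
  have hfin : Module.Finite k E := Module.finite_of_finrank_pos (hdim ▸ hd)
  let e : Module.Basis (Fin d) k E := Module.finBasisOfFinrankEq k E hdim
  have hpow : ∀ i : ℕ, σ ^ i ∈ extAut k.subtype := fun i =>
    (hσ _).2 (Subgroup.npow_mem_zpowers σ i)
  have hfix : ∀ (i : ℕ) (c : k), (σ ^ i) (c : E) = c := fun i c => hpow i c
  have hle : ∀ N : ℕ, Function.Injective (fun i : Fin N => σ ^ (i : ℕ)) → N ≤ d := by
    intro N hN
    let f : (Fin N → Eᵐᵒᵖ) →ₗ[Eᵐᵒᵖ] (Fin d → Eᵐᵒᵖ) :=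
      { toFun := fun v j => ∑ i, v i * MulOpposite.op ((σ ^ (i : ℕ)) (e j))
        map_add' := fun v w => by
          ext j
          simp only [Pi.add_apply, add_mul, Finset.sum_add_distrib]
        map_smul' := fun c v => by
          ext j
          simp only [Pi.smul_apply, smul_eq_mul, RingHom.id_apply, mul_assoc, Finset.mul_sum] }
    refine le_of_fin_injective Eᵐᵒᵖ f ?_
    rw [injective_iff_map_eq_zero]
    intro v hv
    have hv' : ∀ j, ∑ i : Fin N, (σ ^ (i : ℕ)) (e j) * (v i).unop = 0 := fun j => by
      have := congrArg MulOpposite.unop (congrFun hv j)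
      simpa [f] using this
    have hx : ∀ x, ∑ i : Fin N, (σ ^ (i : ℕ)) x * (v i).unop = 0 := by
      intro x
      rw [← e.sum_repr x]
      simp only [map_sum, Finset.sum_mul]
      rw [Finset.sum_comm]
      refine Finset.sum_eq_zero fun j _ => ?_
      have : ∀ i : Fin N, (σ ^ (i : ℕ)) (e.repr x j • e j) * (v i).unop =
          (e.repr x j : E) * ((σ ^ (i : ℕ)) (e j) * (v i).unop) := fun i => by
        rw [Subfield.smul_def, smul_eq_mul, map_mul, hfix, mul_assoc]
      simp only [this]
      rw [← Finset.mul_sum, hv' j, mul_zero]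
    let a : RingAut E → E := Function.extend (fun i : Fin N => σ ^ (i : ℕ))
      (fun i => (v i).unop) 0
    have ha : ∀ i : Fin N, a (σ ^ (i : ℕ)) = (v i).unop := fun i => hN.extend_apply _ _ i
    have h0 := aut_independent hgal.2 (Finset.univ.image fun i : Fin N => σ ^ (i : ℕ))
      (fun g hg => by
        obtain ⟨i, -, rfl⟩ := Finset.mem_image.1 hg
        exact hpow i) a (fun x => by
        rw [Finset.sum_image (fun i _ j _ h => hN h)]
        simp only [ha]
        exact hx x)
    ext i
    have := h0 _ (Finset.mem_image_of_mem _ (Finset.mem_univ i))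
    rw [ha] at this
    simpa using congrArg MulOpposite.op this
  have hpos : 0 < orderOf σ := by
    by_contra h
    have hinj : Function.Injective fun n : ℕ => σ ^ n :=
      injective_pow_iff_not_isOfFinOrder.2 (fun h' => h (orderOf_pos_iff.2 h'))
    have := hle (d + 1) (fun i j h => Fin.ext (hinj h))
    omega
  have hle1 : orderOf σ ≤ d := hle _ (fun i j h =>
    Fin.ext (pow_injOn_Iio_orderOf (Set.mem_Iio.2 i.2) (Set.mem_Iio.2 j.2) h))
  have hle2 : d ≤ orderOf σ := by
    let f : (Fin d → E) →ₗ[E] (Fin (orderOf σ) → E) :=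
      { toFun := fun b i => ∑ j, b j * (σ ^ (i : ℕ)) (e j)
        map_add' := fun v w => by
          ext j
          simp only [Pi.add_apply, add_mul, Finset.sum_add_distrib]
        map_smul' := fun c v => by
          ext j
          simp only [Pi.smul_apply, smul_eq_mul, RingHom.id_apply, mul_assoc, Finset.mul_sum] }
    refine le_of_fin_injective E f ?_
    have key : ∀ s : Finset (Fin d), ∀ b : Fin d → E,
        (∀ i : ℕ, ∑ j, b j * (σ ^ i) (e j) = 0) → (∀ j, j ∉ s → b j = 0) → ∀ j, b j = 0 := by
      intro s
      induction s using Finset.induction_on with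
      | empty => exact fun b _ h j => h j (Finset.notMem_empty j)
      | insert m s hm ih =>
        intro b hb hsupp
        by_cases hbm : b m = 0
        · refine ih b hb fun j hj => ?_
          by_cases hjm : j = m
          · rw [hjm, hbm]
          · exact hsupp j (by simp [hjm, hj])
        · exfalso
          set c : Fin d → E := fun j => (b m)⁻¹ * b j with hc
          have hcm : c m = 1 := inv_mul_cancel₀ hbm
          have hcK : ∀ i : ℕ, ∑ j, c j * (σ ^ i) (e j) = 0 := fun i => by
            have : ∑ j, c j * (σ ^ i) (e j) = (b m)⁻¹ * ∑ j, b j * (σ ^ i) (e j) := by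
              rw [Finset.mul_sum]
              exact Finset.sum_congr rfl fun j _ => mul_assoc _ _ _
            rw [this, hb, mul_zero]
          have hσK : ∀ i : ℕ, ∑ j, σ (c j) * (σ ^ (i + 1)) (e j) = 0 := fun i => by
            have := congrArg σ (hcK i)
            rw [map_sum, map_zero] at this
            rw [← this]
            refine Finset.sum_congr rfl fun j _ => ?_
            rw [pow_succ']
            exact (map_mul σ (c j) ((σ ^ i) (e j))).symm
          have hσK' : ∀ i : ℕ, ∑ j, σ (c j) * (σ ^ i) (e j) = 0 := fun i => by
            have := hσK (i + orderOf σ - 1)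
            rwa [Nat.sub_add_cancel (by omega), pow_add, pow_orderOf_eq_one, mul_one] at this
          have hdiff := ih (fun j => σ (c j) - c j) (fun i => by
            simp only [sub_mul, Finset.sum_sub_distrib]
            rw [hσK', hcK, sub_self]) (fun j hj => by
            by_cases hjm : j = m
            · rw [hjm, hcm, map_one, sub_self]
            · have : c j = 0 := by rw [hc]; simp only [hsupp j (by simp [hjm, hj]), mul_zero]
              rw [this, map_zero, sub_self])
          have hck : ∀ j, ∃ r : k, (r : E) = c j := fun j => by
            refine hgal.1 (c j) fun g hg => ?_
            obtain ⟨z, rfl⟩ := (hσ g).1 hg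
            have hmem : σ ∈ MulAction.stabilizer (RingAut E) (c j) := sub_eq_zero.1 (hdiff j)
            exact zpow_mem hmem z
          choose r hr using hck
          have h0 := hcK 0
          have hlin := Fintype.linearIndependent_iff.1 e.linearIndependent r (by
            rw [← h0]
            refine Finset.sum_congr rfl fun j _ => ?_
            rw [Subfield.smul_def, hr]
            rfl) m
          rw [← hr, hlin] at hcm
          exact zero_ne_one hcm
    rw [injective_iff_map_eq_zero]
    intro b hb
    ext j
    refine key Finset.univ b (fun i => ?_) (fun j hj => absurd (Finset.mem_univ j) hj) j
    have := congrFun hb ⟨i % orderOf σ, Nat.mod_lt _ hpos⟩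
    simp only [f, LinearMap.coe_mk, AddHom.coe_mk, pow_mod_orderOf] at this
    exact this
  rw [le_antisymm hle2 hle1]
  exact pow_orderOf_eq_one σ

end Artin

/-! ### Towers -/

/-- The subfield `k`, seen inside a subfield `K`. -/
abbrev relBase {h : Type u} [DivisionRing h] (k K : Subfield h) : Subfield K := k.comap K.subtype

/-- An extension `h / k` of skew fields with an exhausting tower of cyclic outer Galois
extensions `lvl n / k` of degree `d n`, with compatible generators `σ n` of the Galois groups; a
commutative field `F` embedded in the center of `k`; and sequences `a`, `l` of natural numbers
such that `u n : lvl n (t, σ n ^ a n) → lvl (n + 1) (t, σ (n + 1) ^ a (n + 1))`,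
`t ↦ t ^ (l (n + 1) / l n)`, is well defined and `t ^ l n` is central in `lvl n (t, σ n ^ a n)`. -/
structure TowerData (F : Type v) (h : Type u) [Field F] [DivisionRing h] where
  k : Subfield h
  lvl : ℕ → Subfield h
  mono : Monotone lvl
  exhaust : ∀ x, ∃ n, x ∈ lvl n
  base_le : ∀ n, k ≤ lvl n
  outerGalois : ∀ n, IsOuterGalois (relBase k (lvl n)).subtype
  d : ℕ → ℕ
  d_pos : ∀ n, 0 < d n
  finrank_eq : ∀ n, Module.finrank (relBase k (lvl n)) (lvl n) = d n
  σ : ∀ n, RingAut (lvl n)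
  σ_gen : ∀ n g, g ∈ extAut (relBase k (lvl n)).subtype ↔ g ∈ Subgroup.zpowers (σ n)
  σ_compat : ∀ m n (hmn : m ≤ n) (x : lvl m),
    σ n (Subfield.inclusion (mono hmn) x) = Subfield.inclusion (mono hmn) (σ m x)
  ι : F →+* h
  ι_mem : ∀ c, ι c ∈ k
  ι_comm : ∀ c, ∀ x ∈ k, ι c * x = x * ι c
  a : ℕ → ℕ
  l : ℕ → ℕ
  l_pos : ∀ n, 0 < l n
  l_dvd_succ : ∀ n, l n ∣ l (n + 1)
  d_dvd_sub : ∀ n, (d n : ℤ) ∣ (a (n + 1) * (l (n + 1) / l n) : ℕ) - (a n : ℤ)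
  d_dvd_mul : ∀ n, d n ∣ l n * a n

namespace TowerData

variable {F : Type v} {h : Type u} [Field F] [DivisionRing h] (T : TowerData F h)

/-- The inclusion `lvl i → lvl j`. -/
def incl (i j : ℕ) (hij : i ≤ j) : T.lvl i →+* T.lvl j := Subfield.inclusion (T.mono hij)

theorem incl_pow (i j : ℕ) (hij : i ≤ j) (n : ℕ) (x : T.lvl i) :
    (T.σ j ^ n) (T.incl i j hij x) = T.incl i j hij ((T.σ i ^ n) x) := by
  induction n generalizing x with
  | zero => rfl
  | succ n ih =>
    rw [pow_succ, pow_succ]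
    change (T.σ j ^ n) (T.σ j (T.incl i j hij x)) = T.incl i j hij ((T.σ i ^ n) (T.σ i x))
    rw [← ih]
    exact congrArg _ (T.σ_compat i j hij x)

theorem σ_pow_d (n : ℕ) : T.σ n ^ T.d n = 1 :=
  pow_finrank_eq_one (T.outerGalois n) (T.σ_gen n) (T.d_pos n) (T.finrank_eq n)

theorem σ_pow_succ (n : ℕ) : T.σ n ^ (T.a (n + 1) * (T.l (n + 1) / T.l n)) = T.σ n ^ T.a n := by
  have h1 : T.a n ≡ T.a (n + 1) * (T.l (n + 1) / T.l n) [MOD T.d n] := by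
    rw [Nat.modEq_iff_dvd]
    exact T.d_dvd_sub n
  exact (pow_eq_pow_iff_modEq.2 (h1.of_dvd (orderOf_dvd_of_pow_eq_one (T.σ_pow_d n)))).symm

theorem l_dvd (i j : ℕ) (hij : i ≤ j) : T.l i ∣ T.l j := by
  induction j, hij using Nat.le_induction with
  | base => exact dvd_rfl
  | succ j _ ih => exact ih.trans (T.l_dvd_succ j)

theorem σ_pow_eq (i j : ℕ) (hij : i ≤ j) :
    T.σ i ^ (T.a j * (T.l j / T.l i)) = T.σ i ^ T.a i := by
  induction j, hij using Nat.le_induction with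
  | base => rw [Nat.div_self (T.l_pos i), mul_one]
  | succ j hij ih =>
    have h1 : T.σ i ^ (T.a (j + 1) * (T.l (j + 1) / T.l j)) = T.σ i ^ T.a j := by
      ext x
      have h2 : T.incl i j hij ((T.σ i ^ (T.a (j + 1) * (T.l (j + 1) / T.l j))) x) =
          T.incl i j hij ((T.σ i ^ T.a j) x) := by
        rw [← incl_pow, ← incl_pow, σ_pow_succ]
      exact congrArg Subtype.val ((T.incl i j hij).injective h2)
    have h3 : T.l (j + 1) / T.l i = T.l (j + 1) / T.l j * (T.l j / T.l i) := by
      rw [Nat.div_mul_div_comm (T.l_dvd_succ j) (T.l_dvd i j hij), mul_comm (T.l (j + 1)),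
        Nat.mul_div_mul_left _ _ (T.l_pos j)]
    rw [h3, ← mul_assoc, pow_mul, h1, ← pow_mul, ih]

/-- `F → lvl n`. -/
def ιLvl (n : ℕ) : F →+* T.lvl n :=
  T.ι.codRestrict (T.lvl n) (fun c => T.base_le n (T.ι_mem c))

theorem ιLvl_comm (n : ℕ) (c : F) (x : T.lvl n) : T.ιLvl n c * x = x * T.ιLvl n c := by
  by_cases hc : c = 0
  · rw [hc, map_zero, zero_mul, mul_zero]
  · have hc' : T.ιLvl n c ≠ 0 := (map_ne_zero _).2 hc
    have h1 := (T.outerGalois n).2 (Units.mk0 _ hc') (fun r => by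
      change T.ιLvl n c * (r : T.lvl n) * (T.ιLvl n c)⁻¹ = r
      rw [mul_inv_eq_iff_eq_mul₀ hc']
      exact Subtype.ext (T.ι_comm c _ r.2)) x
    change T.ιLvl n c * x * (T.ιLvl n c)⁻¹ = x at h1
    exact (mul_inv_eq_iff_eq_mul₀ hc').1 h1

theorem ι_central (c : F) (x : h) : T.ι c * x = x * T.ι c := by
  obtain ⟨n, hn⟩ := T.exhaust x
  exact congrArg Subtype.val (T.ιLvl_comm n c ⟨x, hn⟩)

/-- The directed system of the fields `lvl n (t, σ n ^ a n)`, with transition morphisms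
`t ↦ t ^ (l j / l i)`. -/
@[reducible]
def sys : SkewSystem F (fun n => T.lvl n) where
  φ := T.incl
  φ_self _ _ := rfl
  φ_comp _ _ _ _ _ _ := rfl
  ι := T.ιLvl
  φ_ι _ _ _ _ := rfl
  ι_comm := T.ιLvl_comm
  ψ n := T.σ n ^ T.a n
  ψ_ι n c := by
    have h1 : T.σ n ^ T.a n ∈ extAut (relBase T.k (T.lvl n)).subtype :=
      (T.σ_gen n _).2 (Subgroup.npow_mem_zpowers _ _)
    exact h1 ⟨T.ιLvl n c, T.ι_mem c⟩
  l := T.l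
  l_pos := T.l_pos
  l_dvd := T.l_dvd
  ψ_pow n := by
    obtain ⟨q, hq⟩ := T.d_dvd_mul n
    rw [← pow_mul, mul_comm, hq, pow_mul, σ_pow_d, one_pow]
  φ_ψ i j hij x := by
    rw [← pow_mul, T.incl_pow, T.σ_pow_eq i j hij]

/-- `H = lim lvl n (t, σ n ^ a n)`. -/
abbrev H : Type u := T.sys.Lim

/-- `H_G = lim lvl n (t, σ n ^ a n) ⊗ L_{l n}`. -/
abbrev HG (L : IntermediateField (RatFunc F) F⸨X⸩) : Type (max u v) := T.sys.ExtLim L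

theorem of_C_eq {i j : ℕ} (hij : i ≤ j) (x : T.lvl i) :
    T.sys.of i (T.sys.C i x) = T.sys.of j (T.sys.C j (T.incl i j hij x)) := by
  rw [← T.sys.of_trans i j hij]
  exact congrArg _ (T.sys.transHom_C i j hij x)

/-- The level at which an element of `h` appears. -/
noncomputable def index (x : h) : ℕ := (T.exhaust x).choose

theorem mem_index (x : h) : x ∈ T.lvl (T.index x) := (T.exhaust x).choose_spec

theorem of_C_eq_index {n : ℕ} {x : h} (hx : x ∈ T.lvl n) :
    T.sys.of (T.index x) (T.sys.C _ ⟨x, T.mem_index x⟩) = T.sys.of n (T.sys.C n ⟨x, hx⟩) := by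
  rw [T.of_C_eq (le_max_left (T.index x) n), T.of_C_eq (le_max_right (T.index x) n)]
  rfl

/-- The embedding `h → H`, the limit of the inclusions `lvl n → lvl n (t, σ n ^ a n)`. -/
noncomputable def α : h →+* T.H where
  toFun x := T.sys.of (T.index x) (T.sys.C _ ⟨x, T.mem_index x⟩)
  map_zero' := by
    rw [T.of_C_eq_index (zero_mem (T.lvl 0))]
    exact (congrArg _ (map_zero (T.sys.C 0))).trans (map_zero _)
  map_one' := by
    rw [T.of_C_eq_index (one_mem (T.lvl 0))]
    exact (congrArg _ (map_one (T.sys.C 0))).trans (map_one _)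
  map_add' x y := by
    obtain ⟨n, hx, hy⟩ : ∃ n, x ∈ T.lvl n ∧ y ∈ T.lvl n :=
      ⟨max (T.index x) (T.index y), T.mono (le_max_left _ _) (T.mem_index x),
        T.mono (le_max_right _ _) (T.mem_index y)⟩
    rw [T.of_C_eq_index hx, T.of_C_eq_index hy, T.of_C_eq_index (add_mem hx hy), ← map_add,
      ← map_add]
    rfl
  map_mul' x y := by
    obtain ⟨n, hx, hy⟩ : ∃ n, x ∈ T.lvl n ∧ y ∈ T.lvl n :=
      ⟨max (T.index x) (T.index y), T.mono (le_max_left _ _) (T.mem_index x),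
        T.mono (le_max_right _ _) (T.mem_index y)⟩
    rw [T.of_C_eq_index hx, T.of_C_eq_index hy, T.of_C_eq_index (mul_mem hx hy), ← map_mul,
      ← map_mul]
    rfl

theorem α_eq {n : ℕ} {x : h} (hx : x ∈ T.lvl n) :
    T.α x = T.sys.of n (T.sys.C n ⟨x, hx⟩) := T.of_C_eq_index hx

/-- The embedding `h → H → H_G`. -/
noncomputable def αG (L : IntermediateField (RatFunc F) F⸨X⸩) : h →+* T.HG L :=
  (T.sys.limToExtLim L : T.H →+* T.HG L).comp T.α

/-- `t_n`, the image of `t ∈ lvl n (t, σ n ^ a n)` in `H`. -/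
noncomputable def tt (n : ℕ) : T.H := T.sys.of n (T.sys.X n)

/-- `Ω n`, the compositum in `H` of `h` and `lvl n (t, σ n ^ a n)`. -/
noncomputable def Ω (n : ℕ) : Subfield T.H :=
  Subfield.closure (Set.range T.α ∪ Set.range (T.sys.of n))

theorem algebraMap_mem_Ω (n : ℕ) (r : RatFunc F) : algebraMap (RatFunc F) T.H r ∈ T.Ω n :=
  Subfield.subset_closure (Or.inr ⟨algebraMap (RatFunc F) _ r, (T.sys.of n).commutes r⟩)

/-- `Ω n` is an algebra over `F(t ^ (l n)) ≅ F(X)`, which it contains. -/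
noncomputable instance (n : ℕ) : Algebra (RatFunc F) (T.Ω n) :=
  ((algebraMap (RatFunc F) T.H).codRestrict (T.Ω n) (T.algebraMap_mem_Ω n)).toAlgebra'
    (fun r x => Subtype.ext (Algebra.commutes r (x : T.H)))

/-- The inclusion `Ω n → H`. -/
noncomputable def Ωval (n : ℕ) : T.Ω n →ₐ[RatFunc F] T.H where
  __ := (T.Ω n).subtype
  commutes' _ := rfl

/-- The morphism `Ω n ⊗ L_{l n} → H_G`. -/
noncomputable def Ωext (L : IntermediateField (RatFunc F) F⸨X⸩) (n : ℕ) :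
    T.Ω n ⊗[RatFunc F] LPow L (T.l n) (T.l_pos n) →ₐ[RatFunc F] T.HG L :=
  Algebra.TensorProduct.lift ((T.sys.limToExtLim L).comp (T.Ωval n)) (T.sys.LToExtLim L n)
    (fun x y => T.sys.commute_limToExtLim L n x y)

/-- The conditions on automorphisms `ψ n` of `h` under which the fields `h(t, ψ n)` contain
`F(t ^ (l n))` in their centers and form a directed system for `t ↦ t ^ (l j / l i)`. -/
def IsCompatible (ψ : ℕ → RingAut h) : Prop :=
  (∀ n c, ψ n (T.ι c) = T.ι c) ∧ (∀ n, ψ n ^ T.l n = 1) ∧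
    ∀ i j, i ≤ j → ψ i = ψ j ^ (T.l j / T.l i)

variable {T} in
/-- The directed system of the fields `h(t, ψ n)`, with transition morphisms
`t ↦ t ^ (l j / l i)`. -/
@[reducible]
def IsCompatible.sys {ψ : ℕ → RingAut h} (hψ : T.IsCompatible ψ) :
    SkewSystem F (fun _ => h) where
  φ _ _ _ := RingHom.id h
  φ_self _ _ := rfl
  φ_comp _ _ _ _ _ _ := rfl
  ι _ := T.ι
  φ_ι _ _ _ _ := rfl
  ι_comm _ := T.ι_central
  ψ := ψ
  ψ_ι := hψ.1
  l := T.l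
  l_pos := T.l_pos
  l_dvd := T.l_dvd
  ψ_pow := hψ.2.1
  φ_ψ i j hij x := by
    change ψ i x = _
    rw [hψ.2.2 i j hij]
    rfl

end TowerData

end SkewTower

/-! Two mechanisms carry the proof: Laurent series for a single field `D(t, ψ)`, and conjugation by
`t_n` for the tower.

Let `ψ ^ l = 1`, with `ψ` trivial on `F`. Sending `a` to left multiplication by `a` and `t` to `ψ`
times a central variable embeds `D(t, ψ)` into Laurent series over `End_F D`. Series in `F((t ^ l))`
become central scalar series there, so `D(t, ψ) ⊗ L_l` maps to the same ring.
`polyToLaurent_linearDisjoint` shows that this map kills no nonzero element, and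
`exists_leadsAt_tensorToLaurent` shows that the image of a nonzero element of degree `v` has an
injective leading coefficient of the form `c • ψ ^ v`. There are two consequences. Leading terms
multiply, so the tensor product has no zero divisors; as `L` is algebraic over `F(t)`, it is then a
skew field. And an element outside `D` can be translated by an element of `D` to have nonzero order,
after which its powers have distinct orders and are left independent over `D`
(`exists_pow_independent`); this excludes algebraicity over `D`.

The Galois statement is general algebra for a Galois extension `E / K` and a `K`-algebra `M` that is
a skew field. The centralizer of `M` in `M ⊗ E` is `Z(M) ⊗ E`, which is central. Hence the extension
is outer, and an automorphism over `M` must permute roots of minimal polynomials inside `E`.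

For the tower, `t_n = t_m ^ (l_m / l_n)` when `m ≥ n`, so conjugation by `t_n` preserves every large
level and therefore `h`. It defines `ψ_n`, whose order divides `l_n` because `t_n ^ l_n` is central.
The powers of `t_n` are left independent over `h`, which gives `h(t, ψ_n) ≅ Ω_n` (`toΩ_bijective`).
Every element of `H` lies in some `Ω_n`, and every element of `H_G` in the image of some `h(t, ψ_n)
⊗ L_{l_n}`. Regularity over `h` thus reduces to the single-field result with `D = h`. -/

namespace SkewTower

/-! ### Skew Laurent series as Laurent series of endomorphisms -/

section SkewLaurent

variable {F : Type v} {D : Type u} [Field F] [DivisionRing D] [Algebra F D]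

/-- `A` is semilinear for right multiplication, twisted by `ψ ^ v`; equivalently
`A = c • ψ ^ v` for some `c ∈ D`. -/
def IsTwisted (ψ : RingAut D) (v : ℤ) (A : Module.End F D) : Prop :=
  ∀ x y, A (x * y) = A x * (ψ ^ v) y

namespace IsTwisted

variable {ψ : RingAut D} {v w : ℤ} {A B : Module.End F D}

theorem mul (hA : IsTwisted ψ v A) (hB : IsTwisted ψ w B) : IsTwisted ψ (v + w) (A * B) := by
  intro x y
  rw [Module.End.mul_apply, hB, hA, zpow_add]
  rfl

theorem zero : IsTwisted ψ v (0 : Module.End F D) := fun x y => by simp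

theorem add (hA : IsTwisted ψ v A) (hB : IsTwisted ψ v B) : IsTwisted ψ v (A + B) := by
  intro x y
  rw [LinearMap.add_apply, hA, hB, LinearMap.add_apply, add_mul]

theorem neg (hA : IsTwisted ψ v A) : IsTwisted ψ v (-A) := by
  intro x y
  rw [LinearMap.neg_apply, hA, LinearMap.neg_apply, neg_mul]

theorem sum {ι : Type*} {s : Finset ι} {f : ι → Module.End F D}
    (hf : ∀ i ∈ s, IsTwisted ψ v (f i)) : IsTwisted ψ v (∑ i ∈ s, f i) :=
  Finset.sum_induction f (IsTwisted ψ v) (fun _ _ => add) zero hf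

theorem apply_eq (hA : IsTwisted ψ v A) (x : D) : A x = A 1 * (ψ ^ v) x := by
  rw [← hA, one_mul]

/-- A twisted map is `x ↦ A 1 * (ψ ^ v) x`, and `A 1` is invertible unless `A` vanishes. -/
theorem injective (hA : IsTwisted ψ v A) (h0 : A ≠ 0) : Function.Injective A := by
  have h1 : A 1 ≠ 0 := fun h => h0 (LinearMap.ext fun x => by
    rw [hA.apply_eq, h, zero_mul, LinearMap.zero_apply])
  intro x y hxy
  rw [hA.apply_eq x, hA.apply_eq y] at hxy
  exact (ψ ^ v).injective (mul_left_cancel₀ h1 hxy)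

/-- Left cancellation of twisted maps. It recovers the shape of an unknown coefficient from that of
a product. -/
theorem of_mul_left (hA : IsTwisted ψ v A) (hinj : Function.Injective A)
    (hAB : IsTwisted ψ (v + w) (A * B)) : IsTwisted ψ w B := by
  intro x y
  apply hinj
  have h := hAB x y
  rw [Module.End.mul_apply, Module.End.mul_apply, zpow_add] at h
  rw [h, hA]
  rfl

end IsTwisted

/-- An automorphism of `D` over `F`, as an endomorphism of the vector space `D`. -/
def twistEnd (ψ : RingAut D) (hψ : ∀ c, ψ (algebraMap F D c) = algebraMap F D c) :
    Module.End F D where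
  toFun := ψ
  map_add' := map_add ψ
  map_smul' c x := by rw [Algebra.smul_def, map_mul, hψ, ← Algebra.smul_def]; rfl

section

variable {ψ : RingAut D} (hψ : ∀ c, ψ (algebraMap F D c) = algebraMap F D c)

theorem twistEnd_pow_apply (n : ℕ) (x : D) : (twistEnd ψ hψ ^ n) x = (ψ ^ n) x := by
  induction n generalizing x with
  | zero => rfl
  | succ n ih =>
    rw [pow_succ, pow_succ, Module.End.mul_apply, ih]
    rfl

theorem isTwisted_lmul_mul_pow (a : D) (n : ℕ) :
    IsTwisted ψ n (Algebra.lmul F D a * twistEnd ψ hψ ^ n) := by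
  intro x y
  rw [Module.End.mul_apply, twistEnd_pow_apply, Module.End.mul_apply, twistEnd_pow_apply, map_mul,
    zpow_natCast]
  exact (mul_assoc _ _ _).symm

/-- The embedding of `D[t, ψ]` into power series with coefficients in `End D`. -/
noncomputable def polyToSeries : SkewPoly ψ →+* PowerSeries (Module.End F D) :=
  SkewMonoidAlgebra.liftNCRingHom (k := Twist ψ)
    (((PowerSeries.C (R := Module.End F D)).comp (Algebra.lmul F D : D →+* Module.End F D)).comp
      ((Twist.of ψ).symm : Twist ψ →+* D))
    (powersHom _ (PowerSeries.X * PowerSeries.C (twistEnd ψ hψ))) (by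
      intro a y
      change PowerSeries.C (Algebra.lmul F D ((ψ ^ (Multiplicative.toAdd y))
        ((Twist.of ψ).symm a))) * (PowerSeries.X * PowerSeries.C _) ^ (Multiplicative.toAdd y) =
        (PowerSeries.X * PowerSeries.C _) ^ (Multiplicative.toAdd y) *
        PowerSeries.C (Algebra.lmul F D ((Twist.of ψ).symm a))
      generalize Multiplicative.toAdd y = n
      generalize (Twist.of ψ).symm a = b
      -- The variable of the series is central, so its power splits off; what remains is
      -- multiplicativity of `ψ ^ n`.
      rw [(PowerSeries.commute_X (PowerSeries.C (twistEnd ψ hψ))).symm.mul_pow, mul_assoc,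
        ← map_pow, ← map_mul, ← mul_assoc,
        (PowerSeries.commute_X_pow _ n).eq, mul_assoc, ← map_mul]
      congr 2
      ext x
      rw [Module.End.mul_apply, Module.End.mul_apply, twistEnd_pow_apply, twistEnd_pow_apply]
      exact (map_mul (ψ ^ n) b x).symm)

theorem polyToSeries_monomial (n : ℕ) (a : D) :
    polyToSeries hψ (SkewPolynomial.monomial n (Twist.of ψ a)) =
      PowerSeries.monomial n (Algebra.lmul F D a * twistEnd ψ hψ ^ n) := by
  have h : polyToSeries hψ (SkewPolynomial.monomial n (Twist.of ψ a)) =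
      PowerSeries.C (Algebra.lmul F D a) * (PowerSeries.X * PowerSeries.C (twistEnd ψ hψ)) ^ n :=
    SkewMonoidAlgebra.liftNC_single _ _ _ _
  rw [h, (PowerSeries.commute_X (PowerSeries.C (twistEnd ψ hψ))).symm.mul_pow,
    (PowerSeries.commute_X_pow _ n).symm.eq, ← mul_assoc, ← map_pow, ← map_mul]
  ext m : 1
  rw [PowerSeries.coeff_C_mul, PowerSeries.coeff_X_pow, PowerSeries.coeff_monomial]
  split_ifs <;> simp

theorem coeff_polyToSeries (p : SkewPoly ψ) (n : ℕ) :
    PowerSeries.coeff n (polyToSeries hψ p) =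
      Algebra.lmul F D ((Twist.of ψ).symm (p.coeff n)) * twistEnd ψ hψ ^ n := by
  conv_lhs => rw [← SkewPolynomial.sum_monomial p, SkewPolynomial.sum_def, map_sum, map_sum]
  have h : ∀ m ∈ p.support, PowerSeries.coeff n (polyToSeries hψ
      (SkewPolynomial.monomial m (p.coeff m))) = if m = n then
        Algebra.lmul F D ((Twist.of ψ).symm (p.coeff n)) * twistEnd ψ hψ ^ n else 0 := by
    intro m _
    refine (congrArg _ (polyToSeries_monomial hψ m ((Twist.of ψ).symm (p.coeff m)))).trans ?_
    rw [PowerSeries.coeff_monomial]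
    rcases eq_or_ne m n with rfl | hmn
    · rw [if_pos rfl]
    · rw [if_neg hmn, if_neg hmn.symm]
  rw [Finset.sum_congr rfl h, Finset.sum_ite_eq']
  split_ifs with hn
  · rfl
  · rw [SkewPolynomial.notMem_support_iff.1 hn, map_zero, map_zero, zero_mul]

theorem isUnit_twistEnd : IsUnit (twistEnd ψ hψ) := by
  refine (Module.End.isUnit_iff _).2 ψ.bijective

/-- The embedding of `D[t, ψ]` into Laurent series with coefficients in `End D`. -/
noncomputable def polyToLaurent : SkewPoly ψ →+* HahnSeries ℤ (Module.End F D) :=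
  (HahnSeries.ofPowerSeries ℤ _).comp (polyToSeries hψ)

theorem coeff_polyToLaurent (p : SkewPoly ψ) (n : ℕ) :
    (polyToLaurent hψ p).coeff n =
      Algebra.lmul F D ((Twist.of ψ).symm (p.coeff n)) * twistEnd ψ hψ ^ n := by
  rw [polyToLaurent, RingHom.comp_apply, HahnSeries.ofPowerSeries_apply_coeff, coeff_polyToSeries]

theorem coeff_polyToLaurent_of_neg (p : SkewPoly ψ) {n : ℤ} (hn : n < 0) :
    (polyToLaurent hψ p).coeff n = 0 := by
  rw [polyToLaurent, RingHom.comp_apply, HahnSeries.ofPowerSeries_apply]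
  refine HahnSeries.embDomain_of_notMem_range ?_
  rintro ⟨m, rfl⟩
  exact absurd hn (not_lt.2 (Int.natCast_nonneg m))

/-- Factor out the lowest power of the variable. The remaining power series has as constant term a
nonzero multiplication composed with a power of `ψ`, a unit of `End D`. This is what lets the
embedding extend to fractions. -/
theorem isUnit_polyToLaurent {p : SkewPoly ψ} (hp : p ≠ 0) : IsUnit (polyToLaurent hψ p) := by
  classical
  have hex : ∃ n, p.coeff n ≠ 0 := by
    by_contra! h
    exact hp (coeff_ext h)
  have hmin := Nat.find_spec hex
  have hlt : ∀ m, m < Nat.find hex → p.coeff m = 0 := fun m hm => not_not.1 (Nat.find_min hex hm)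
  generalize Nat.find hex = n at hmin hlt
  have hdvd : (PowerSeries.X : PowerSeries (Module.End F D)) ^ n ∣ polyToSeries hψ p := by
    rw [PowerSeries.X_pow_dvd_iff]
    intro m hm
    rw [coeff_polyToSeries, hlt m hm, map_zero, map_zero, zero_mul]
  obtain ⟨q, hq⟩ := hdvd
  have hq0 : PowerSeries.coeff 0 q =
      Algebra.lmul F D ((Twist.of ψ).symm (p.coeff n)) * twistEnd ψ hψ ^ n := by
    rw [← coeff_polyToSeries, hq, PowerSeries.coeff_X_pow_mul', if_pos le_rfl, Nat.sub_self]
  have hunit : IsUnit (PowerSeries.constantCoeff q) := by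
    rw [← PowerSeries.coeff_zero_eq_constantCoeff_apply, hq0]
    refine IsUnit.mul (IsUnit.map _ (IsUnit.mk0 _ ?_)) ((isUnit_twistEnd hψ).pow n)
    exact (map_ne_zero_iff _ (Twist.of ψ).symm.injective).2 hmin
  have hqu : IsUnit q := MvPowerSeries.isUnit_iff_constantCoeff.2 hunit
  have hX : IsUnit (HahnSeries.single (n : ℤ) (1 : Module.End F D)) :=
    ⟨⟨_, HahnSeries.single (-(n : ℤ)) 1, by simp, by simp⟩, rfl⟩
  rw [polyToLaurent, RingHom.comp_apply, hq, map_mul, HahnSeries.ofPowerSeries_X_pow]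
  exact hX.mul (hqu.map _)

/-- The embedding of `D(t, ψ)` into Laurent series with coefficients in `End D`. -/
noncomputable def fracToLaurent : SkewFrac ψ →+* HahnSeries ℤ (Module.End F D) :=
  OreLocalization.universalHom (polyToLaurent hψ)
    (IsUnit.liftRight ((polyToLaurent hψ : SkewPoly ψ →* _).comp (SkewPoly ψ)⁰.subtype)
      (fun s => isUnit_polyToLaurent hψ (nonZeroDivisors.coe_ne_zero s)))
    (fun _ => rfl)

theorem fracToLaurent_ofPoly (p : SkewPoly ψ) :
    fracToLaurent hψ (SkewFrac.ofPoly ψ p) = polyToLaurent hψ p :=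
  OreLocalization.universalHom_commutes _ _ _

theorem fracToLaurent_C (a : D) :
    fracToLaurent hψ (SkewFrac.C ψ a) = HahnSeries.C (Algebra.lmul F D a) := by
  refine (fracToLaurent_ofPoly hψ _).trans ?_
  refine (congrArg (HahnSeries.ofPowerSeries ℤ _) (polyToSeries_monomial hψ 0 a)).trans ?_
  rw [pow_zero, mul_one, PowerSeries.monomial_zero_eq_C_apply, HahnSeries.ofPowerSeries_C]

theorem fracToLaurent_X :
    fracToLaurent hψ (SkewFrac.X ψ) = HahnSeries.single 1 (twistEnd ψ hψ) := by
  refine (fracToLaurent_ofPoly hψ _).trans ?_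
  refine (congrArg (HahnSeries.ofPowerSeries ℤ _) (polyToSeries_monomial hψ 1 1)).trans ?_
  have h : PowerSeries.monomial 1 (twistEnd ψ hψ) =
      PowerSeries.C (twistEnd ψ hψ) * PowerSeries.X := by
    ext m : 1
    rw [PowerSeries.coeff_C_mul, PowerSeries.coeff_X, PowerSeries.coeff_monomial]
    split_ifs <;> simp
  rw [pow_one, map_one, one_mul, h, map_mul, HahnSeries.ofPowerSeries_C, HahnSeries.ofPowerSeries_X]
  simp

end

/-- The skew Laurent series: the coefficient of `t ^ i` is of the form `c • ψ ^ i`. -/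
def skewLaurent (F : Type v) [Field F] [Algebra F D] (ψ : RingAut D) :
    Subring (HahnSeries ℤ (Module.End F D)) where
  carrier := {a | ∀ i, IsTwisted ψ i (a.coeff i)}
  zero_mem' i := IsTwisted.zero
  one_mem' i := by
    rw [HahnSeries.coeff_one]
    split_ifs with h
    · subst h
      exact fun x y => rfl
    · exact IsTwisted.zero
  add_mem' ha hb i := (ha i).add (hb i)
  neg_mem' ha i := (ha i).neg
  mul_mem' {a b} ha hb i := by
    rw [HahnSeries.coeff_mul]
    refine IsTwisted.sum fun ij hij => ?_
    rw [← (Finset.mem_antidiagonal.1 hij).2.2]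
    exact (ha _).mul (hb _)

theorem polyToLaurent_mem {ψ : RingAut D} (hψ : ∀ c, ψ (algebraMap F D c) = algebraMap F D c)
    (p : SkewPoly ψ) : polyToLaurent hψ p ∈ skewLaurent F ψ := by
  intro i
  rcases lt_or_ge i 0 with hi | hi
  · rw [coeff_polyToLaurent_of_neg hψ p hi]
    exact IsTwisted.zero
  · obtain ⟨n, rfl⟩ := Int.eq_ofNat_of_zero_le hi
    rw [coeff_polyToLaurent]
    exact isTwisted_lmul_mul_pow hψ _ n

/-- `a` has order `v`, with an injective leading coefficient. -/
def LeadsAt (a : HahnSeries ℤ (Module.End F D)) (v : ℤ) : Prop :=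
  (∀ i < v, a.coeff i = 0) ∧ Function.Injective (a.coeff v)

namespace LeadsAt

variable {a b : HahnSeries ℤ (Module.End F D)} {v w : ℤ}

theorem ne_zero (ha : LeadsAt a v) : a ≠ 0 := by
  rintro rfl
  exact one_ne_zero (ha.2 (show (0 : Module.End F D) 1 = (0 : Module.End F D) 0 from rfl))

/-- The lowest coefficient of the product is the composite of the two leading coefficients. `End D`
has zero divisors in general, but injective maps compose to injective maps. -/
theorem mul (ha : LeadsAt a v) (hb : LeadsAt b w) : LeadsAt (a * b) (v + w) := by
  have hcoeff : ∀ i ≤ v + w, (a * b).coeff i = if i = v + w then a.coeff v * b.coeff w else 0 := by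
    intro i hi
    rw [HahnSeries.coeff_mul]
    split_ifs with h
    · subst h
      refine Finset.sum_eq_single (v, w) ?_ ?_
      · rintro ⟨j, k⟩ hjk hne
        have h := (Finset.mem_antidiagonal.1 hjk).2.2
        simp only at h
        rcases lt_trichotomy j v with hj | hj | hj
        · rw [ha.1 j hj, zero_mul]
        · exact absurd (by ext <;> simp only <;> omega) hne
        · rw [hb.1 k (by omega), mul_zero]
      · intro h
        by_cases h1 : a.coeff v = 0
        · rw [h1, zero_mul]
        by_cases h2 : b.coeff w = 0
        · rw [h2, mul_zero]
        · exact absurd (Finset.mem_antidiagonal.2 ⟨h1, h2, rfl⟩) h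
    · refine Finset.sum_eq_zero ?_
      rintro ⟨j, k⟩ hjk
      have h := (Finset.mem_antidiagonal.1 hjk).2.2
      simp only at h
      rcases lt_or_ge j v with hj | hj
      · rw [ha.1 j hj, zero_mul]
      · rw [hb.1 k (by omega), mul_zero]
  refine ⟨fun i hi => by rw [hcoeff i hi.le, if_neg hi.ne], ?_⟩
  rw [hcoeff _ le_rfl, if_pos rfl]
  exact ha.2.comp hb.2

theorem one : LeadsAt (1 : HahnSeries ℤ (Module.End F D)) 0 := by
  refine ⟨fun i hi => by rw [HahnSeries.coeff_one, if_neg hi.ne], ?_⟩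
  rw [HahnSeries.coeff_one, if_pos rfl]
  exact fun _ _ h => h

theorem pow (ha : LeadsAt a v) (n : ℕ) : LeadsAt (a ^ n) (n * v) := by
  induction n with
  | zero => simpa using one
  | succ n ih =>
    rw [pow_succ, Nat.cast_succ, add_mul, one_mul]
    exact ih.mul ha

theorem C_lmul {c : D} (hc : c ≠ 0) :
    LeadsAt (HahnSeries.C (Algebra.lmul F D c) : HahnSeries ℤ (Module.End F D)) 0 := by
  refine ⟨fun i hi => by rw [HahnSeries.C_apply, HahnSeries.coeff_single_of_ne hi.ne], ?_⟩
  rw [HahnSeries.C_apply, HahnSeries.coeff_single_same]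
  exact fun x y h => mul_left_cancel₀ hc h

/-- Powers of an element of nonzero order are left linearly independent over `D`. -/
theorem coeff_eq_zero (ha : LeadsAt a v) (hv : v ≠ 0) (s : Finset ℕ) (c : ℕ → D)
    (h : ∑ n ∈ s, HahnSeries.C (Algebra.lmul F D (c n)) * a ^ n = 0) : ∀ n ∈ s, c n = 0 := by
  classical
  by_contra! hne
  obtain ⟨n, hn, hcn⟩ := hne
  -- The terms with nonzero coefficient have the distinct orders `n * v`. Minimizing `n * v`, not
  -- `n`, treats both signs of `v`; the coefficient of the sum at the minimum is that of one term.
  obtain ⟨m, hm, hmin⟩ := Finset.exists_min_image (s.filter fun n => c n ≠ 0)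
    (fun n => (n : ℤ) * v) ⟨n, Finset.mem_filter.2 ⟨hn, hcn⟩⟩
  obtain ⟨hms, hcm⟩ := Finset.mem_filter.1 hm
  have hlead : ∀ n, c n ≠ 0 →
      LeadsAt (HahnSeries.C (Algebra.lmul F D (c n)) * a ^ n) (n * v) := fun n hcn => by
    simpa using (C_lmul hcn).mul (ha.pow n)
  have h1 := congrArg (fun b => HahnSeries.coeff b ((m : ℤ) * v)) h
  simp only [HahnSeries.coeff_sum, HahnSeries.coeff_zero] at h1
  rw [Finset.sum_eq_single m] at h1
  · have := (hlead m hcm).2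
    rw [h1] at this
    exact one_ne_zero (this (show (0 : Module.End F D) 1 = (0 : Module.End F D) 0 from rfl))
  · intro n hn hnm
    by_cases hcn : c n = 0
    · rw [hcn, map_zero, map_zero, zero_mul, HahnSeries.coeff_zero]
    · refine (hlead n hcn).1 _ (lt_of_le_of_ne (hmin n (Finset.mem_filter.2 ⟨hn, hcn⟩)) ?_)
      intro heq
      exact hnm (by exact_mod_cast (mul_right_cancel₀ hv heq).symm)
  · exact fun h => absurd hms h

end LeadsAt

/-- If `s` and `s * a` are skew Laurent series, then so is the leading term of `a`. -/
theorem exists_leadsAt {ψ : RingAut D} {s a : HahnSeries ℤ (Module.End F D)}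
    (hs : s ∈ skewLaurent F ψ) (hs0 : s ≠ 0) (hsa : s * a ∈ skewLaurent F ψ) (ha : a ≠ 0) :
    ∃ v, LeadsAt a v ∧ IsTwisted ψ v (a.coeff v) := by
  -- The coefficient of `s * a` at the sum of the orders is the product of the two leading
  -- coefficients, and that of `s` is injective, so it cancels.
  have htw : IsTwisted ψ a.order (a.coeff a.order) := by
    refine (hs s.order).of_mul_left ((hs s.order).injective ?_) ?_
    · rw [← HahnSeries.leadingCoeff_eq]
      exact HahnSeries.leadingCoeff_ne_zero.2 hs0
    · have := hsa (s.order + a.order)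
      rwa [HahnSeries.coeff_mul_order_add_order, HahnSeries.leadingCoeff_eq,
        HahnSeries.leadingCoeff_eq] at this
  refine ⟨a.order, ⟨fun i hi => HahnSeries.coeff_eq_zero_of_lt_order hi, htw.injective ?_⟩, htw⟩
  rw [← HahnSeries.leadingCoeff_eq]
  exact HahnSeries.leadingCoeff_ne_zero.2 ha

end SkewLaurent


/-! ### The substitution `t ↦ t ^ m` on coefficients, and rational functions as Laurent series. -/

section PowSubst

variable {F : Type v} [Field F]

theorem coeff_powSubst_mul (m : ℕ) (hm : 0 < m) (x : F⸨X⸩) (j : ℤ) :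
    (powSubst m hm x).coeff (m * j) = x.coeff j :=
  HahnSeries.embDomain_coeff (f := ⟨⟨_, _⟩, _⟩) (a := j)

theorem coeff_powSubst_of_not_dvd (m : ℕ) (hm : 0 < m) (x : F⸨X⸩) {j : ℤ} (hj : ¬ (m : ℤ) ∣ j) :
    (powSubst m hm x).coeff j = 0 :=
  HahnSeries.embDomain_of_notMem_range (f := ⟨⟨_, _⟩, _⟩) (by
    rintro ⟨a, rfl⟩
    exact hj ⟨a, rfl⟩)

theorem powSubst_C (m : ℕ) (hm : 0 < m) (c : F) :
    powSubst m hm (HahnSeries.C c) = HahnSeries.C c :=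
  HahnSeries.embDomainRingHom_C

theorem powSubst_single (m : ℕ) (hm : 0 < m) (j : ℤ) (c : F) :
    powSubst m hm (HahnSeries.single j c) = HahnSeries.single (m * j : ℤ) c :=
  HahnSeries.embDomain_single (f := ⟨⟨_, _⟩, _⟩)

theorem algebraMap_polynomial_laurent (p : Polynomial F) :
    algebraMap (RatFunc F) F⸨X⸩ (algebraMap (Polynomial F) (RatFunc F) p) =
      algebraMap (Polynomial F) F⸨X⸩ p :=
  (IsScalarTower.algebraMap_apply _ _ _ _).symm

theorem algebraMap_ratFunc_laurent_C (c : F) :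
    algebraMap (RatFunc F) F⸨X⸩ (RatFunc.C c) = HahnSeries.C c := by
  rw [← RatFunc.algebraMap_C, algebraMap_polynomial_laurent]
  simp

theorem algebraMap_ratFunc_laurent_X :
    algebraMap (RatFunc F) F⸨X⸩ RatFunc.X = HahnSeries.single 1 1 := by
  rw [← RatFunc.algebraMap_X, algebraMap_polynomial_laurent]
  simp

theorem algebraMap_ratFunc_laurent_monomial (n : ℕ) (c : F) :
    algebraMap (RatFunc F) F⸨X⸩ (algebraMap (Polynomial F) (RatFunc F)
      (Polynomial.monomial n c)) = HahnSeries.single (n : ℤ) c := by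
  rw [← Polynomial.C_mul_X_pow_eq_monomial, map_mul, map_mul, map_pow, map_pow,
    RatFunc.algebraMap_C, RatFunc.algebraMap_X, algebraMap_ratFunc_laurent_C,
    algebraMap_ratFunc_laurent_X]
  simp

/-- The target is an arbitrary ring, since Laurent series over `End D` need not form a field.
Denominators still map to units and can be cancelled. -/
theorem ratFunc_ringHom_ext {R : Type*} [Ring R] {f g : RatFunc F →+* R}
    (hC : ∀ c, f (RatFunc.C c) = g (RatFunc.C c)) (hX : f RatFunc.X = g RatFunc.X) : f = g := by
  have h : f.comp (algebraMap (Polynomial F) (RatFunc F)) =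
      g.comp (algebraMap (Polynomial F) (RatFunc F)) := by
    refine Polynomial.ringHom_ext (fun c => ?_) ?_
    · simpa using hC c
    · simpa using hX
  have hpoly : ∀ p, f (algebraMap (Polynomial F) (RatFunc F) p) =
      g (algebraMap (Polynomial F) (RatFunc F) p) := RingHom.congr_fun h
  ext x
  induction x using RatFunc.induction_on with
  | f p q hq =>
    have hq' : algebraMap (Polynomial F) (RatFunc F) q ≠ 0 :=
      (map_ne_zero_iff _ (IsFractionRing.injective _ _)).2 hq
    refine (((IsUnit.mk0 _ hq').map f).mul_left_inj).1 ?_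
    rw [← map_mul, div_mul_cancel₀ _ hq', hpoly, hpoly, ← map_mul, div_mul_cancel₀ _ hq']

end PowSubst

/-! ### Central scalar Laurent series. -/

section Scalars

variable {F : Type v} [Field F] (A : Type u) [Ring A] [Algebra F A]

/-- Laurent series over `F` as Laurent series over an `F`-algebra `A`. -/
noncomputable def scalarLaurent : F⸨X⸩ →+* HahnSeries ℤ A where
  toFun x := x.map (algebraMap F A)
  map_zero' := by ext; simp
  map_one' := by
    ext i
    rw [HahnSeries.map_coeff, HahnSeries.coeff_one, HahnSeries.coeff_one]
    split_ifs <;> simp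
  map_add' x y := by ext; simp
  map_mul' x y := by
    ext i
    rw [HahnSeries.map_coeff, HahnSeries.coeff_mul, HahnSeries.coeff_mul, map_sum]
    have hmap : ∀ z : F⸨X⸩, ∀ i, (z.map (algebraMap F A)).coeff i ≠ 0 → z.coeff i ≠ 0 :=
      fun z i h hz => h (by rw [HahnSeries.map_coeff, hz, map_zero])
    -- Mapping coefficients may shrink supports, so the two convolution sums range over different
    -- index sets; the additional terms vanish.
    refine (Finset.sum_subset_zero_on_sdiff ?_ ?_ ?_).symm
    · rintro ⟨j, k⟩ hjk
      obtain ⟨h1, h2, h3⟩ := Finset.mem_antidiagonal.1 hjk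
      exact Finset.mem_antidiagonal.2 ⟨hmap x _ h1, hmap y _ h2, h3⟩
    · rintro ⟨j, k⟩ hjk
      obtain ⟨h1, h2⟩ := Finset.mem_sdiff.1 hjk
      rw [map_mul]
      by_contra hne
      exact h2 (Finset.mem_antidiagonal.2 ⟨left_ne_zero_of_mul hne, right_ne_zero_of_mul hne,
        (Finset.mem_antidiagonal.1 h1).2.2⟩)
    · exact fun jk _ => (map_mul (algebraMap F A) _ _).symm

variable {A}

theorem coeff_scalarLaurent (x : F⸨X⸩) (i : ℤ) :
    (scalarLaurent A x).coeff i = algebraMap F A (x.coeff i) := rfl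

/-- The coefficients from `F` are central in `A`, and exchanging the factors swaps the antidiagonal.
-/
theorem scalarLaurent_comm (x : F⸨X⸩) (b : HahnSeries ℤ A) :
    scalarLaurent A x * b = b * scalarLaurent A x := by
  ext i
  simp_rw [HahnSeries.coeff_mul, coeff_scalarLaurent, Algebra.commutes]
  exact Finset.sum_equiv (Equiv.prodComm _ _)
    (fun _ ↦ Finset.swap_mem_antidiagonal.symm) <| by simp

theorem scalarLaurent_C (c : F) :
    scalarLaurent A (HahnSeries.C c) = HahnSeries.C (algebraMap F A c) := by
  ext i
  rw [coeff_scalarLaurent, HahnSeries.C_apply, HahnSeries.C_apply, HahnSeries.coeff_single,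
    HahnSeries.coeff_single]
  split_ifs <;> simp

theorem scalarLaurent_single (j : ℤ) (c : F) :
    scalarLaurent A (HahnSeries.single j c) = HahnSeries.single j (algebraMap F A c) := by
  ext i
  rw [coeff_scalarLaurent, HahnSeries.coeff_single, HahnSeries.coeff_single]
  split_ifs <;> simp

end Scalars

/-- Finitely many left fractions have a common denominator. -/
theorem SkewFrac.exists_common_denom {D : Type u} [DivisionRing D] (ψ : RingAut D) {ι : Type*}
    (s : Finset ι) (m : ι → SkewFrac ψ) :
    ∃ d : SkewPoly ψ, d ≠ 0 ∧ ∀ i ∈ s, ∃ p, ofPoly ψ d * m i = ofPoly ψ p := by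
  classical
  induction s using Finset.induction_on with
  | empty => exact ⟨1, one_ne_zero, by simp⟩
  | insert j s hj ih =>
    obtain ⟨d, hd, h⟩ := ih
    obtain ⟨r, e, he, hr⟩ : ∃ r e : SkewPoly ψ, e ≠ 0 ∧ ofPoly ψ e * m j = ofPoly ψ r := by
      generalize m j = x
      induction x using OreLocalization.ind with | _ r s
      exact ⟨r, s, nonZeroDivisors.coe_ne_zero s, OreLocalization.mul_cancel (S := (SkewPoly ψ)⁰)⟩
    obtain ⟨N, hN⟩ := exists_bound e
    obtain ⟨a, b, hb, hab⟩ := exists_ore N d e he hN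
    -- By the Ore condition `b * d = a * e` is a left multiple of both the old common denominator
    -- and the denominator of `m j`.
    refine ⟨b * d, mul_ne_zero hb hd, fun i hi => ?_⟩
    rcases Finset.mem_insert.1 hi with rfl | hi
    · exact ⟨a * r, by rw [hab, map_mul, mul_assoc, hr, map_mul]⟩
    · obtain ⟨p, hp⟩ := h i hi
      exact ⟨b * p, by rw [map_mul, mul_assoc, hp, map_mul]⟩

/-! ### Linear disjointness of skew polynomials and series in `t ^ l`. -/

section Disjoint

variable {F : Type v} {D : Type u} [Field F] [DivisionRing D] [Algebra F D]
  {ψ : RingAut D} (hψ : ∀ c, ψ (algebraMap F D c) = algebraMap F D c)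

theorem polyToLaurent_mul_coeff (p : SkewPoly ψ) (a : HahnSeries ℤ (Module.End F D)) (N : ℤ) :
    (polyToLaurent hψ p * a).coeff N = ∑ n ∈ p.support,
      Algebra.lmul F D ((Twist.of ψ).symm (p.coeff n)) * twistEnd ψ hψ ^ n * a.coeff (N - n) := by
  have h : polyToLaurent hψ p = ∑ n ∈ p.support, HahnSeries.single (n : ℤ)
      (Algebra.lmul F D ((Twist.of ψ).symm (p.coeff n)) * twistEnd ψ hψ ^ n) := by
    ext i : 2
    rw [HahnSeries.coeff_sum]
    simp only [HahnSeries.coeff_single]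
    rcases lt_or_ge i 0 with hi | hi
    · rw [coeff_polyToLaurent_of_neg hψ p hi, Finset.sum_eq_zero]
      exact fun n _ => if_neg (by omega)
    · obtain ⟨m, rfl⟩ := Int.eq_ofNat_of_zero_le hi
      rw [coeff_polyToLaurent]
      simp only [Nat.cast_inj, Finset.sum_ite_eq]
      split_ifs with hm
      · rfl
      · rw [SkewPolynomial.notMem_support_iff.1 hm, map_zero, map_zero, zero_mul]
  rw [h, Finset.sum_mul, HahnSeries.coeff_sum]
  exact Finset.sum_congr rfl fun n _ => HahnSeries.coeff_single_mul

variable {l : ℕ} (hl : 0 < l)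

/-- `D[t, ψ]` and `F((t ^ l))` are linearly disjoint over `F(t ^ l)`. -/
theorem polyToLaurent_linearDisjoint {ι : Type*} {e : ι → F⸨X⸩}
    (he : LinearIndependent (RatFunc F) e) (s : Finset ι) (p : ι → SkewPoly ψ)
    (h : ∑ i ∈ s, polyToLaurent hψ (p i) * scalarLaurent (Module.End F D) (powSubst l hl (e i)) = 0) :
    ∀ i ∈ s, p i = 0 := by
  intro i₀ hi₀
  refine coeff_ext fun n₀ => ?_
  -- Linear functionals over `F` separate the points of `D`, so the relation over `D` can be tested
  -- on scalar relations.
  suffices ∀ φ : Module.Dual F D, φ ((Twist.of ψ).symm ((p i₀).coeff n₀)) = 0 by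
    exact (map_eq_zero_iff _ (Twist.of ψ).symm.injective).1
      ((Module.forall_dual_apply_eq_zero_iff F _).1 this)
  intro φ
  let c : ι → ℕ → F := fun i n => φ ((Twist.of ψ).symm ((p i).coeff n))
  -- Only the exponents congruent to `n₀` modulo `l` are kept. Writing `n = n % l + l * (n / l)`
  -- turns them into a polynomial in `t ^ l`.
  let P : ι → Polynomial F := fun i => ∑ n ∈ (p i).support.filter fun n => n % l = n₀ % l,
    Polynomial.monomial (n / l) (c i n)
  have hP : ∑ i ∈ s, algebraMap (Polynomial F) (RatFunc F) (P i) • e i = 0 := by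
    ext j
    -- Evaluating the coefficient at `1` removes the power of `ψ`. In this degree, series in `t ^ l`
    -- meet only the terms of `p i` in the residue class of `n₀`.
    have h1 := congrArg (fun a => φ ((HahnSeries.coeff a ((n₀ % l : ℕ) + l * j)) 1)) h
    simp only [HahnSeries.coeff_sum, HahnSeries.coeff_zero, LinearMap.sum_apply, map_sum,
      LinearMap.zero_apply, map_zero] at h1
    rw [HahnSeries.coeff_sum, HahnSeries.coeff_zero, ← h1]
    refine Finset.sum_congr rfl fun i _ => ?_
    rw [Algebra.smul_def, map_sum, map_sum, Finset.sum_mul, HahnSeries.coeff_sum,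
      polyToLaurent_mul_coeff, LinearMap.sum_apply, map_sum, Finset.sum_filter]
    refine Finset.sum_congr rfl fun n _ => ?_
    rw [coeff_scalarLaurent, Module.End.mul_apply, Module.algebraMap_end_apply,
      (Algebra.lmul F D _ * _).map_smul, map_smul, Module.End.mul_apply, twistEnd_pow_apply, map_one]
    have hlmul : ∀ a : D, Algebra.lmul F D a 1 = a := mul_one
    rw [hlmul]
    have hn := Nat.mod_add_div n l
    split_ifs with hmod
    · rw [algebraMap_ratFunc_laurent_monomial, HahnSeries.coeff_single_mul]
      have : ((n₀ % l : ℕ) + l * j - n : ℤ) = l * (j - (n / l : ℕ)) := by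
        have hn' : ((n % l : ℕ) : ℤ) + l * (n / l : ℕ) = n := by exact_mod_cast hn
        rw [← hmod, ← hn']
        ring
      rw [this, coeff_powSubst_mul, smul_eq_mul, mul_comm]
    · rw [coeff_powSubst_of_not_dvd, zero_smul]
      rintro ⟨q, hq⟩
      apply hmod
      have h2 : (n : ℤ) ≡ n₀ [ZMOD l] := by
        have h3 : ((n₀ % l : ℕ) : ℤ) = n + l * (q - j) := by linarith
        have h4 : ((n₀ % l : ℕ) : ℤ) ≡ n [ZMOD l] := by
          rw [h3]
          exact (Int.modEq_iff_dvd.2 ⟨-(q - j), by ring⟩)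
        exact h4.symm.trans (by rw [Int.natCast_mod]; exact Int.mod_modEq _ _)
      exact (Int.natCast_modEq_iff.1 h2)
  have hP0 := linearIndependent_iff'.1 he s _ hP i₀ hi₀
  have hP1 : P i₀ = 0 := (map_eq_zero_iff _ (IsFractionRing.injective _ _)).1 hP0
  have h2 := congrArg (fun q => Polynomial.coeff q (n₀ / l)) hP1
  simp only [P, Polynomial.finsetSum_coeff, Polynomial.coeff_monomial, Polynomial.coeff_zero] at h2
  -- Within one residue class the quotient by `l` determines the exponent, so the coefficient of `P
  -- i₀` at `n₀ / l` comes from `n₀` alone.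
  by_cases hn₀ : n₀ ∈ (p i₀).support
  · rw [Finset.sum_eq_single n₀, if_pos rfl] at h2
    · exact h2
    · intro n hn hne
      refine if_neg fun hdiv => hne ?_
      rw [← Nat.mod_add_div n l, ← Nat.mod_add_div n₀ l, hdiv, (Finset.mem_filter.1 hn).2]
    · exact fun h => (h (Finset.mem_filter.2 ⟨hn₀, rfl⟩)).elim
  · rw [SkewPolynomial.notMem_support_iff.1 hn₀, map_zero, map_zero]

/-- Only degrees divisible by `l` occur, and there the required twist is a power of `ψ ^ l = 1`; a
scalar satisfies it. -/
theorem scalarLaurent_powSubst_mem (hpow : ψ ^ l = 1) (x : F⸨X⸩) :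
    scalarLaurent (Module.End F D) (powSubst l hl x) ∈ skewLaurent F ψ := by
  intro i
  rw [coeff_scalarLaurent]
  by_cases hi : (l : ℤ) ∣ i
  · obtain ⟨j, rfl⟩ := hi
    intro x y
    rw [zpow_mul, zpow_natCast, hpow, one_zpow, Module.algebraMap_end_apply,
      Module.algebraMap_end_apply]
    exact (smul_mul_assoc _ _ _).symm
  · rw [coeff_powSubst_of_not_dvd _ _ _ hi, map_zero]
    exact IsTwisted.zero

variable [Algebra (RatFunc F) (SkewFrac ψ)]
  (hC : ∀ c, algebraMap (RatFunc F) (SkewFrac ψ) (RatFunc.C c) =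
    SkewFrac.C ψ (algebraMap F D c))
  (hX : algebraMap (RatFunc F) (SkewFrac ψ) RatFunc.X = SkewFrac.X ψ ^ l)
  (hpow : ψ ^ l = 1)

include hC hX hpow in
-- The `l`-th power of `t` maps to `ψ ^ l = 1` in degree `l`, a scalar series. The two maps on the
-- tensor factors therefore agree on `F(t ^ l)`.
theorem fracToLaurent_algebraMap (r : RatFunc F) :
    fracToLaurent hψ (algebraMap (RatFunc F) (SkewFrac ψ) r) =
      scalarLaurent (Module.End F D) (powSubst l hl (algebraMap (RatFunc F) F⸨X⸩ r)) := by
  have h : (fracToLaurent hψ).comp (algebraMap (RatFunc F) (SkewFrac ψ)) =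
      ((scalarLaurent (Module.End F D)).comp (powSubst l hl)).comp
        (algebraMap (RatFunc F) F⸨X⸩) := by
    refine ratFunc_ringHom_ext (R := HahnSeries ℤ (Module.End F D)) (fun c => ?_) ?_
    · simp only [RingHom.comp_apply]
      rw [hC, fracToLaurent_C, algebraMap_ratFunc_laurent_C, powSubst_C, scalarLaurent_C]
      congr 1
      ext x
      rw [Module.algebraMap_end_apply, Algebra.smul_def]
      rfl
    · simp only [RingHom.comp_apply]
      rw [hX, map_pow, fracToLaurent_X, algebraMap_ratFunc_laurent_X, powSubst_single,
        scalarLaurent_single, HahnSeries.single_pow, map_one, mul_one, nsmul_eq_mul, mul_one]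
      congr 1
      ext x
      rw [twistEnd_pow_apply, hpow]
      rfl
  exact RingHom.congr_fun h r

end Disjoint


/-! ### Scalar extensions of skew fields by commutative algebraic extensions -/

section TensorField

variable {K M E : Type*} [Field K] [DivisionRing M] [Algebra K M] [Field E] [Algebra K E]

/-- From `x * a = 1` one gets `(a * x - 1) * a = 0`, and `a` can be cancelled. -/
theorem isUnit_of_mul_eq_one_of_noZeroDivisors {A : Type*} [Ring A] [NoZeroDivisors A] {x a : A}
    (h : x * a = 1) : IsUnit a := by
  rcases subsingleton_or_nontrivial A with _ | _
  · exact isUnit_of_subsingleton a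
  have ha : a ≠ 0 := by
    rintro rfl
    rw [mul_zero] at h
    exact zero_ne_one h
  refine ⟨⟨a, x, ?_, h⟩, rfl⟩
  have : (a * x - 1) * a = 0 := by rw [sub_mul, mul_assoc, h, mul_one, one_mul, sub_self]
  exact sub_eq_zero.1 ((mul_eq_zero.1 this).resolve_right ha)

/-- Right multiplication by `a` is linear for the left `M`-structure and injective. In finite
dimension it is surjective, which gives a left inverse of `a`. -/
theorem isUnit_tensor_of_finiteDimensional [FiniteDimensional K E] [NoZeroDivisors (M ⊗[K] E)]
    {a : M ⊗[K] E} (ha : a ≠ 0) : IsUnit a := by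
  have hsmul : ∀ (m : M) (x : M ⊗[K] E), (m • x) * a = m • (x * a) := by
    intro m x
    have h : ∀ x : M ⊗[K] E, m • x = (m ⊗ₜ 1) * x := by
      intro x
      induction x using TensorProduct.induction_on with
      | zero => rw [smul_zero, mul_zero]
      | tmul y z => rw [TensorProduct.smul_tmul', Algebra.TensorProduct.tmul_mul_tmul, one_mul,
          smul_eq_mul]
      | add y z hy hz => rw [smul_add, mul_add, hy, hz]
    rw [h, h, mul_assoc]
  let f : M ⊗[K] E →ₗ[M] M ⊗[K] E :=
    { toFun := fun x => x * a
      map_add' := fun x y => add_mul x y a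
      map_smul' := hsmul }
  have hf : Function.Injective f := by
    rw [injective_iff_map_eq_zero]
    exact fun x hx => (mul_eq_zero.1 hx).resolve_right ha
  obtain ⟨x, hx⟩ := LinearMap.injective_iff_surjective.1 hf 1
  exact isUnit_of_mul_eq_one_of_noZeroDivisors hx

theorem nontrivial_tensor : Nontrivial (M ⊗[K] E) :=
  (Algebra.TensorProduct.includeLeft_injective (S := K) (A := M)
    (algebraMap K E).injective).nontrivial

/-- A tensor involves finitely many elements of `E`, which generate a finite subextension `E'`. By
flatness `M ⊗ E'` embeds in `M ⊗ E`, so it inherits the absence of zero divisors and the finite case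
applies. -/
theorem isSkewField_tensor [Algebra.IsAlgebraic K E] [NoZeroDivisors (M ⊗[K] E)] :
    IsSkewField (M ⊗[K] E) := by
  classical
  refine ⟨nontrivial_tensor, fun a ha => ?_⟩
  obtain ⟨S, hS⟩ := TensorProduct.exists_finset a
  let E' := IntermediateField.adjoin K (Prod.snd '' (S : Set (M × E)))
  have hfin : FiniteDimensional K E' := by
    have : Finite (Prod.snd '' (S : Set (M × E))) := (S.finite_toSet.image _).to_subtype
    exact IntermediateField.finiteDimensional_adjoin fun x _ =>
      (Algebra.IsAlgebraic.isAlgebraic x).isIntegral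
  let f : M ⊗[K] E' →ₐ[K] M ⊗[K] E := Algebra.TensorProduct.map (AlgHom.id K M) E'.val
  have hf : Function.Injective f :=
    Module.Flat.lTensor_preserves_injective_linearMap (M := M) E'.val.toLinearMap
      E'.val.injective
  have : NoZeroDivisors (M ⊗[K] E') := hf.noZeroDivisors f (map_zero f) (map_mul f)
  have hmem : a ∈ f.range := by
    rw [hS]
    refine Subalgebra.sum_mem _ fun i hi => ?_
    exact ⟨i.1 ⊗ₜ ⟨i.2, IntermediateField.subset_adjoin K _ ⟨i, hi, rfl⟩⟩, by
      exact Algebra.TensorProduct.map_tmul _ _ _ _⟩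
  obtain ⟨a', rfl⟩ := hmem
  refine (isUnit_tensor_of_finiteDimensional (a := a') ?_).map (f : _ →+* M ⊗[K] E)
  rintro rfl
  exact ha (map_zero f)

/-- The elements of `M ⊗ E` that commute with `M` are central. -/
theorem commute_of_commute_left {c : M ⊗[K] E} (hc : ∀ m : M, (m ⊗ₜ 1) * c = c * (m ⊗ₜ 1))
    (x : M ⊗[K] E) : x * c = c * x := by
  have hmem : c ∈ Subalgebra.centralizer K
      (Algebra.TensorProduct.includeLeft (S := K) (B := E) '' (Set.univ : Set M)) := by
    rw [Subalgebra.mem_centralizer_iff]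
    rintro _ ⟨m, -, rfl⟩
    exact hc m
  -- The centralizer of `M` is `Z(M) ⊗ E`, and its pure tensors commute with all pure tensors
  -- because `E` is commutative.
  rw [Subalgebra.centralizer_coe_image_includeLeft_eq_center_tensorProduct] at hmem
  obtain ⟨w, rfl⟩ := hmem
  clear hc
  change x * Algebra.TensorProduct.map _ _ w = Algebra.TensorProduct.map _ _ w * x
  induction w using TensorProduct.induction_on with
  | zero => rw [map_zero, mul_zero, zero_mul]
  | add y z hy hz => rw [map_add, mul_add, add_mul, hy, hz]
  | tmul z e =>
    have hz := (Subalgebra.mem_centralizer_iff K).1 z.2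
    rw [Algebra.TensorProduct.map_tmul]
    induction x using TensorProduct.induction_on with
    | zero => rw [mul_zero, zero_mul]
    | add y z hy hz => rw [mul_add, add_mul, hy, hz]
    | tmul m y =>
      rw [Algebra.TensorProduct.tmul_mul_tmul, Algebra.TensorProduct.tmul_mul_tmul, mul_comm]
      exact congrArg (· ⊗ₜ[K] _) (hz m (Set.mem_univ m))

/-- Elements of `M ⊗ E` fixed by the Galois group of `E` lie in `M`. -/
theorem mem_range_of_fixed [IsGalois K E] {x : M ⊗[K] E}
    (hx : ∀ g : E ≃ₐ[K] E, Algebra.TensorProduct.map (AlgHom.id K M) (g : E →ₐ[K] E) x = x) :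
    ∃ m : M, x = m ⊗ₜ 1 := by
  classical
  -- Over a `K`-basis of `M` the coordinates in `E` are unique and the Galois group acts on each
  -- separately, so they are all fixed and lie in `K`.
  let ℬ := Module.Free.chooseBasis K M
  obtain ⟨b, rfl⟩ := TensorProduct.eq_repr_basis_left ℬ x
  have hfix : ∀ (g : E ≃ₐ[K] E) i, g (b i) = b i := by
    intro g i
    have h := hx g
    have h0 : (b.mapRange g (map_zero g) - b).sum (fun i n => ℬ i ⊗ₜ[K] n) = 0 := by
      rw [Finsupp.sum_sub_index (fun _ _ _ => TensorProduct.tmul_sub _ _ _),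
        Finsupp.sum_mapRange_index (fun _ => TensorProduct.tmul_zero _ _), sub_eq_zero]
      conv_rhs => rw [← h]
      rw [Finsupp.sum, Finsupp.sum, map_sum]
      rfl
    have h1 := TensorProduct.sum_tmul_basis_left_eq_zero ℬ _ h0
    exact sub_eq_zero.1 (DFunLike.congr_fun h1 i)
  have hK : ∀ i, ∃ c : K, algebraMap K E c = b i := fun i => by
    have := (InfiniteGalois.mem_bot_iff_fixed (k := K) (b i)).2 (fun g => hfix g i)
    exact IntermediateField.mem_bot.1 this
  choose c hc using hK
  refine ⟨∑ i ∈ b.support, c i • ℬ i, ?_⟩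
  rw [Finsupp.sum, TensorProduct.sum_tmul]
  refine Finset.sum_congr rfl fun i _ => ?_
  rw [TensorProduct.smul_tmul, ← hc, Algebra.algebraMap_eq_smul_one]

/-- An automorphism of `M ⊗ E` over `M` preserves `E`. -/
theorem exists_tmul_of_mem_extAut [Normal K E] [NoZeroDivisors (M ⊗[K] E)]
    {θ : RingAut (M ⊗[K] E)}
    (hθ : θ ∈ extAut (Algebra.TensorProduct.includeLeftRingHom : M →+* M ⊗[K] E)) (y : E) :
    ∃ y', θ (1 ⊗ₜ y) = 1 ⊗ₜ y' := by
  have hM : ∀ m : M, θ (m ⊗ₜ 1) = m ⊗ₜ 1 := hθ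
  have : Nontrivial (M ⊗[K] E) := nontrivial_tensor
  -- The image of `1 ⊗ y` commutes with `M` and is therefore central. The center is a commutative
  -- domain containing `E`, in which a split polynomial has only its roots from `E`.
  let Z := Subalgebra.center K (M ⊗[K] E)
  have : IsDomain Z := NoZeroDivisors.to_isDomain _
  have hcenter : ∀ c : M ⊗[K] E, (∀ m : M, (m ⊗ₜ 1) * c = c * (m ⊗ₜ 1)) → c ∈ Z := fun c hc =>
    Subalgebra.mem_center_iff.2 (commute_of_commute_left hc)
  have hcomm : ∀ (m : M) (y : E), (m ⊗ₜ 1 : M ⊗[K] E) * (1 ⊗ₜ y) = (1 ⊗ₜ y) * (m ⊗ₜ 1) :=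
    fun m y => by simp
  let j : E →ₐ[K] Z := (Algebra.TensorProduct.includeRight (A := M)).codRestrict Z
    (fun y => hcenter _ fun m => hcomm m y)
  let θK : M ⊗[K] E →ₐ[K] M ⊗[K] E :=
    { (θ : M ⊗[K] E →+* M ⊗[K] E) with
      commutes' := fun r => hM (algebraMap K M r) }
  let z : Z := ⟨θ (1 ⊗ₜ y), hcenter _ fun m => by
    have := congrArg θ (hcomm m y)
    rwa [map_mul, map_mul, hM] at this⟩
  -- `θ` is the identity on `K`, so it carries a root of the minimal polynomial to a root.
  have hz : Polynomial.aeval z (minpoly K y) = 0 := by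
    apply Subtype.ext
    have h1 : ((Polynomial.aeval z (minpoly K y) : Z) : M ⊗[K] E) =
        Polynomial.aeval (θK (Algebra.TensorProduct.includeRight y)) (minpoly K y) :=
      (Polynomial.aeval_algHom_apply Z.val z _).symm
    rw [h1, Polynomial.aeval_algHom_apply, Polynomial.aeval_algHom_apply, minpoly.aeval, map_zero,
      map_zero]
    rfl
  have hsplit := Normal.splits ‹Normal K E› y
  have hprod := hsplit.eq_prod_roots
  rw [Polynomial.Monic.leadingCoeff ((minpoly.monic (Normal.isIntegral ‹_› y)).map _), map_one,
    one_mul] at hprod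
  have h2 : Polynomial.eval₂ (j : E →+* Z) z ((minpoly K y).map (algebraMap K E)) = 0 := by
    rw [Polynomial.eval₂_map, AlgHom.comp_algebraMap]
    exact hz
  rw [hprod, ← Polynomial.coe_eval₂RingHom, map_multiset_prod, Multiset.map_map,
    Multiset.prod_eq_zero_iff] at h2
  obtain ⟨y', -, hy'⟩ := Multiset.mem_map.1 h2
  refine ⟨y', ?_⟩
  have h3 : z - j y' = 0 := by simpa using hy'
  exact congrArg Subtype.val (sub_eq_zero.1 h3)

variable (K M E) in
/-- Automorphisms of `E` over `K` act on `M ⊗ E`. -/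
noncomputable def tensorAut : (E ≃ₐ[K] E) →*
    extAut (Algebra.TensorProduct.includeLeftRingHom : M →+* M ⊗[K] E) where
  toFun g := ⟨(Algebra.TensorProduct.congr (AlgEquiv.refl : M ≃ₐ[K] M) g).toRingEquiv,
    fun m => by
      change Algebra.TensorProduct.congr (AlgEquiv.refl : M ≃ₐ[K] M) g (m ⊗ₜ 1) = m ⊗ₜ 1
      simp⟩
  map_one' := by
    apply Subtype.ext
    ext x
    change Algebra.TensorProduct.map (AlgHom.id K M) (AlgHom.id K E) x = x
    simp
  map_mul' g g' := by
    apply Subtype.ext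
    ext x
    change Algebra.TensorProduct.map (AlgHom.id K M) ((g : E →ₐ[K] E).comp (g' : E →ₐ[K] E)) x =
      Algebra.TensorProduct.map (AlgHom.id K M) (g : E →ₐ[K] E)
        (Algebra.TensorProduct.map (AlgHom.id K M) (g' : E →ₐ[K] E) x)
    rw [← AlgHom.comp_apply, ← Algebra.TensorProduct.map_comp, AlgHom.comp_id]

theorem tensorAut_tmul (g : E ≃ₐ[K] E) (m : M) (y : E) :
    (tensorAut K M E g : RingAut (M ⊗[K] E)) (m ⊗ₜ y) = m ⊗ₜ g y := rfl

theorem includeRight_tensor_injective : Function.Injective fun y : E => (1 ⊗ₜ y : M ⊗[K] E) :=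
  Algebra.TensorProduct.includeRight_injective (algebraMap K M).injective

/-- An automorphism over `M` induces a `K`-endomorphism of `E`, bijective because `E / K` is
algebraic. It is determined by this restriction, since `M` and `E` generate the tensor product. -/
theorem tensorAut_bijective [Normal K E] [NoZeroDivisors (M ⊗[K] E)] :
    Function.Bijective (tensorAut K M E) := by
  constructor
  · intro g g' h
    ext y
    apply includeRight_tensor_injective (K := K) (M := M)
    exact DFunLike.congr_fun (congrArg Subtype.val h) (1 ⊗ₜ y)
  · rintro ⟨θ, hθ⟩
    choose g hg using exists_tmul_of_mem_extAut hθ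
    have hinj := includeRight_tensor_injective (K := K) (M := M) (E := E)
    let g' : E →ₐ[K] E :=
      { toFun := g
        map_one' := hinj (by
          change (1 ⊗ₜ g 1 : M ⊗[K] E) = 1 ⊗ₜ 1
          rw [← hg]
          exact map_one θ)
        map_zero' := hinj (by
          change (1 ⊗ₜ g 0 : M ⊗[K] E) = 1 ⊗ₜ 0
          rw [← hg, TensorProduct.tmul_zero, map_zero])
        map_add' := fun x y => hinj (by
          change (1 ⊗ₜ g (x + y) : M ⊗[K] E) = 1 ⊗ₜ (g x + g y)
          rw [← hg, TensorProduct.tmul_add, TensorProduct.tmul_add, map_add, hg, hg])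
        map_mul' := fun x y => hinj (by
          change (1 ⊗ₜ g (x * y) : M ⊗[K] E) = 1 ⊗ₜ (g x * g y)
          have h : ∀ a b : E, (1 ⊗ₜ (a * b) : M ⊗[K] E) = (1 ⊗ₜ a) * (1 ⊗ₜ b) := by simp
          rw [← hg, h, h, map_mul, hg, hg])
        commutes' := fun r => hinj (by
          change (1 ⊗ₜ g (algebraMap K E r) : M ⊗[K] E) = 1 ⊗ₜ algebraMap K E r
          rw [← hg, Algebra.algebraMap_eq_smul_one, ← TensorProduct.smul_tmul]
          exact hθ _) }
    refine ⟨AlgEquiv.ofBijective g' (Algebra.IsAlgebraic.algHom_bijective g'), ?_⟩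
    apply Subtype.ext
    ext x
    induction x using TensorProduct.induction_on with
    | zero => rw [map_zero, map_zero]
    | add x y hx hy => rw [map_add, map_add, hx, hy]
    | tmul m y =>
      rw [tensorAut_tmul]
      have h : ∀ z : E, (m ⊗ₜ z : M ⊗[K] E) = (m ⊗ₜ 1) * (1 ⊗ₜ z) := by simp
      change (m ⊗ₜ g y : M ⊗[K] E) = θ (m ⊗ₜ y)
      rw [h y, h (g y), map_mul, hg]
      exact congrArg (· * _) (hθ m).symm

/-- Automorphisms coming from `E` already have fixed ring `M`; a unit commuting with `M` is central,
so its inner automorphism is trivial. -/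
theorem isOuterGalois_tensor [IsGalois K E] :
    IsOuterGalois (Algebra.TensorProduct.includeLeftRingHom : M →+* M ⊗[K] E) := by
  constructor
  · intro x hx
    obtain ⟨m, rfl⟩ := mem_range_of_fixed (x := x) fun g => hx _ (tensorAut K M E g).2
    exact ⟨m, rfl⟩
  · intro c hc x
    have h : ∀ m : M, (m ⊗ₜ 1 : M ⊗[K] E) * (c : M ⊗[K] E) = (c : M ⊗[K] E) * (m ⊗ₜ 1) := fun m =>
      ((Units.mul_inv_eq_iff_eq_mul c).1 (hc m)).symm
    rw [← commute_of_commute_left (c := (c : M ⊗[K] E)) h, Units.mul_inv_cancel_right]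

end TensorField


/-! ### Leading terms in `D(t, ψ) ⊗ L_l`. -/

section TensorLaurent

variable {F : Type v} {D : Type u} [Field F] [DivisionRing D] [Algebra F D]
  {ψ : RingAut D} (hψ : ∀ c, ψ (algebraMap F D c) = algebraMap F D c)
  {l : ℕ} (hl : 0 < l) (L : IntermediateField (RatFunc F) F⸨X⸩)
  [Algebra (RatFunc F) (SkewFrac ψ)]

/-- The isomorphism `L ≃ L_m`. -/
noncomputable def LPow.equiv {F : Type v} [Field F] (L : IntermediateField (RatFunc F) F⸨X⸩)
    (m : ℕ) (hm : 0 < m) : L ≃ₐ[RatFunc F] LPow L m hm :=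
  AlgEquiv.ofBijective { toLPow L m hm with commutes' := fun _ => rfl }
    ⟨(toLPow L m hm).injective, toLPow_surjective L m hm⟩

/-- The morphism from `D(t, ψ) ⊗ L_l` to Laurent series with coefficients in `End D`. -/
noncomputable def tensorToLaurent (hcomp : ∀ r, fracToLaurent hψ (algebraMap (RatFunc F) _ r) =
      scalarLaurent (Module.End F D) (powSubst l hl (algebraMap (RatFunc F) F⸨X⸩ r))) :
    SkewFrac ψ ⊗[RatFunc F] LPow L l hl →+* HahnSeries ℤ (Module.End F D) :=
  -- This structure sends `X` to the `l`-th power of the variable. It depends on `l`, so it is kept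
  -- local.
  letI : Algebra (RatFunc F) (HahnSeries ℤ (Module.End F D)) :=
    ((scalarLaurent (Module.End F D)).comp
      ((powSubst l hl).comp (algebraMap (RatFunc F) F⸨X⸩))).toAlgebra'
      (fun _ x => scalarLaurent_comm _ x)
  (Algebra.TensorProduct.lift
    ({ fracToLaurent hψ with commutes' := hcomp } :
      SkewFrac ψ →ₐ[RatFunc F] HahnSeries ℤ (Module.End F D))
    ({ (scalarLaurent (Module.End F D)).comp (LPow L l hl).subtype with
        commutes' := fun _ => rfl } :
      LPow L l hl →ₐ[RatFunc F] HahnSeries ℤ (Module.End F D))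
    (fun _ _ => (scalarLaurent_comm _ _).symm)).toRingHom

variable (hcomp : ∀ r, fracToLaurent hψ (algebraMap (RatFunc F) _ r) =
      scalarLaurent (Module.End F D) (powSubst l hl (algebraMap (RatFunc F) F⸨X⸩ r)))

theorem tensorToLaurent_tmul (m : SkewFrac ψ) (y : LPow L l hl) :
    tensorToLaurent hψ hl L hcomp (m ⊗ₜ y) =
      fracToLaurent hψ m * scalarLaurent (Module.End F D) (y : F⸨X⸩) := by
  unfold tensorToLaurent
  let : Algebra (RatFunc F) (HahnSeries ℤ (Module.End F D)) :=
    ((scalarLaurent (Module.End F D)).comp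
      ((powSubst l hl).comp (algebraMap (RatFunc F) F⸨X⸩))).toAlgebra'
      (fun _ x => scalarLaurent_comm _ x)
  exact Algebra.TensorProduct.lift_tmul _ _ _ _ _

/-- Nonzero elements of `D(t, ψ) ⊗ L_l` have a leading term. -/
theorem exists_leadsAt_tensorToLaurent (hpow : ψ ^ l = 1)
    {x : SkewFrac ψ ⊗[RatFunc F] LPow L l hl} (hx : x ≠ 0) :
    ∃ v, LeadsAt (tensorToLaurent hψ hl L hcomp x) v ∧
      IsTwisted ψ v ((tensorToLaurent hψ hl L hcomp x).coeff v) := by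
  let ℬ := Module.Free.chooseBasis (RatFunc F) L
  let 𝒞 := ℬ.map (LPow.equiv L l hl).toLinearEquiv
  obtain ⟨b, hb⟩ := TensorProduct.eq_repr_basis_right 𝒞 x
  obtain ⟨d, hd, hp⟩ := SkewFrac.exists_common_denom ψ b.support b
  choose! p hp using hp
  -- Multiplying by a common left denominator replaces the coordinates of `x` by skew polynomials,
  -- where linear disjointness is available. It also exhibits `d` times the image as a skew Laurent
  -- series.
  have hΘ : polyToLaurent hψ d * tensorToLaurent hψ hl L hcomp x = ∑ i ∈ b.support,
      polyToLaurent hψ (p i) * scalarLaurent (Module.End F D) (powSubst l hl (ℬ i : F⸨X⸩)) := by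
    rw [← hb, Finsupp.sum, map_sum, Finset.mul_sum]
    refine Finset.sum_congr rfl fun i hi => ?_
    rw [tensorToLaurent_tmul, ← mul_assoc, ← fracToLaurent_ofPoly, ← map_mul, hp i hi,
      fracToLaurent_ofPoly]
    rfl
  have hmem : ∀ y : L, scalarLaurent (Module.End F D) (powSubst l hl (y : F⸨X⸩)) ∈
      skewLaurent F ψ := fun y => scalarLaurent_powSubst_mem hl hpow (y : F⸨X⸩)
  have hd0 : polyToLaurent hψ d ≠ 0 := (isUnit_polyToLaurent hψ hd).ne_zero
  refine exists_leadsAt (F := F) (polyToLaurent_mem hψ d) hd0 ?_ ?_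
  · rw [hΘ]
    exact sum_mem fun i _ => mul_mem (polyToLaurent_mem hψ (p i)) (hmem (ℬ i))
  · intro h0
    rw [h0, mul_zero] at hΘ
    have hp0 := polyToLaurent_linearDisjoint hψ hl (e := fun i => (ℬ i : F⸨X⸩))
      (ℬ.linearIndependent.map' L.val.toLinearMap
        (LinearMap.ker_eq_bot.2 L.val.injective)) b.support p hΘ.symm
    apply hx
    rw [← hb, Finsupp.sum]
    refine Finset.sum_eq_zero fun i hi => ?_
    have hi0 := hp i hi
    rw [hp0 i hi, map_zero] at hi0
    rw [(mul_eq_zero.1 hi0).resolve_left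
      ((map_ne_zero_iff _ (SkewFrac.ofPoly_injective ψ)).2 hd), TensorProduct.zero_tmul]

include hcomp in
-- Leading terms of nonzero elements multiply to a nonzero leading term.
theorem noZeroDivisors_skewFrac_tensor (hpow : ψ ^ l = 1) :
    NoZeroDivisors (SkewFrac ψ ⊗[RatFunc F] LPow L l hl) where
  eq_zero_or_eq_zero_of_mul_eq_zero {x y} h := by
    by_contra! hne
    obtain ⟨v, hv, -⟩ := exists_leadsAt_tensorToLaurent hψ hl L hcomp hpow hne.1
    obtain ⟨w, hw, -⟩ := exists_leadsAt_tensorToLaurent hψ hl L hcomp hpow hne.2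
    apply (hv.mul hw).ne_zero
    rw [← map_mul, h, map_zero]

include hcomp in
/-- An element of `D(t, ψ) ⊗ L_l` that is not in `D` has a translate by an element of `D` whose
powers are left linearly independent over `D`. -/
theorem exists_pow_independent (hpow : ψ ^ l = 1)
    (x : SkewFrac ψ ⊗[RatFunc F] LPow L l hl) (hx : ∀ c : D, x ≠ SkewFrac.C ψ c ⊗ₜ 1) :
    ∃ c : D, ∀ (s : Finset ℕ) (a : ℕ → D),
      ∑ n ∈ s, (SkewFrac.C ψ (a n) ⊗ₜ 1) * (x - SkewFrac.C ψ c ⊗ₜ 1) ^ n = 0 → ∀ n ∈ s, a n = 0 := by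
  have hΘC : ∀ c : D, tensorToLaurent hψ hl L hcomp (SkewFrac.C ψ c ⊗ₜ 1) =
      HahnSeries.C (Algebra.lmul F D c) := fun c => by
    rw [tensorToLaurent_tmul, fracToLaurent_C]
    exact (congrArg _ (map_one _)).trans (mul_one _)
  have key : ∀ (y : SkewFrac ψ ⊗[RatFunc F] LPow L l hl) (v : ℤ), v ≠ 0 →
      LeadsAt (tensorToLaurent hψ hl L hcomp y) v → ∀ (s : Finset ℕ) (a : ℕ → D),
      ∑ n ∈ s, (SkewFrac.C ψ (a n) ⊗ₜ 1) * y ^ n = 0 → ∀ n ∈ s, a n = 0 := by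
    intro y v hv hlead s a h
    refine hlead.coeff_eq_zero hv s a ?_
    have := congrArg (tensorToLaurent hψ hl L hcomp) h
    rw [map_sum, map_zero] at this
    rw [← this]
    exact Finset.sum_congr rfl fun n _ => by rw [map_mul, map_pow, hΘC]
  have hx0 : x ≠ 0 := by simpa using hx 0
  obtain ⟨v, hv, htw⟩ := exists_leadsAt_tensorToLaurent hψ hl L hcomp hpow hx0
  by_cases hv0 : v = 0
  · subst hv0
    -- In degree `0` a twisted coefficient is left multiplication by its value at `1`. Subtracting
    -- that value cancels the coefficient, so the nonzero difference cannot have order `0`.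
    let c : D := (tensorToLaurent hψ hl L hcomp x).coeff 0 1
    obtain ⟨w, hw, -⟩ := exists_leadsAt_tensorToLaurent hψ hl L hcomp hpow (sub_ne_zero.2 (hx c))
    refine ⟨c, key _ w ?_ hw⟩
    rintro rfl
    have h0 : (tensorToLaurent hψ hl L hcomp (x - SkewFrac.C ψ c ⊗ₜ 1)).coeff 0 = 0 := by
      ext z
      rw [map_sub, hΘC, HahnSeries.coeff_sub, HahnSeries.C_apply, HahnSeries.coeff_single_same,
        LinearMap.sub_apply, htw.apply_eq]
      exact sub_self _
    have := hw.2
    rw [h0] at this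
    exact one_ne_zero (this (show (0 : Module.End F D) 1 = (0 : Module.End F D) 0 from rfl))
  · refine ⟨0, ?_⟩
    rw [map_zero, TensorProduct.zero_tmul, sub_zero]
    exact key x v hv0 hv

end TensorLaurent

/-! ### Field, Galois and independence results for directed systems. -/

namespace SkewSystem

variable {F : Type v} [Field F] {D : ℕ → Type u} [∀ n, DivisionRing (D n)] (S : SkewSystem F D)
  (L : IntermediateField (RatFunc F) F⸨X⸩) (n : ℕ)

/-- `D n` as an algebra over `F`. -/
@[reducible]
noncomputable def coeffAlgebra : Algebra F (D n) := (S.ι n).toAlgebra' (S.ι_comm n)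

noncomputable instance : Algebra (RatFunc F) (SkewFrac (S.ψ n)) :=
  inferInstanceAs (Algebra (RatFunc F) (S.M n))

theorem fracToLaurent_comp (r : RatFunc F) :
    letI := S.coeffAlgebra n
    fracToLaurent (F := F) (S.ψ_ι n) (algebraMap (RatFunc F) (SkewFrac (S.ψ n)) r) =
      scalarLaurent (Module.End F (D n))
        (powSubst (S.l n) (S.l_pos n) (algebraMap (RatFunc F) F⸨X⸩ r)) :=
  letI := S.coeffAlgebra n
  fracToLaurent_algebraMap (S.ψ_ι n) (S.l_pos n) (S.algebraMap_C n) (S.algebraMap_X n) (S.ψ_pow n) r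

instance noZeroDivisors_ext : NoZeroDivisors (S.Ext L n) :=
  letI := S.coeffAlgebra n
  noZeroDivisors_skewFrac_tensor (F := F) (ψ := S.ψ n) (S.ψ_ι n) (S.l_pos n) L
    (S.fracToLaurent_comp n) (S.ψ_pow n)

theorem exists_ext_pow_independent (x : S.Ext L n) (hx : ∀ c : D n, x ≠ S.C n c ⊗ₜ 1) :
    ∃ c : D n, ∀ (s : Finset ℕ) (a : ℕ → D n),
      ∑ i ∈ s, (S.C n (a i) ⊗ₜ 1) * (x - S.C n c ⊗ₜ 1) ^ i = 0 → ∀ i ∈ s, a i = 0 :=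
  letI := S.coeffAlgebra n
  exists_pow_independent (F := F) (ψ := S.ψ n) (S.ψ_ι n) (S.l_pos n) L
    (S.fracToLaurent_comp n) (S.ψ_pow n) x hx

/-- This is the tensor version for the trivial extension `L = F(t)`, pulled back along `y ↦ y ⊗ 1`.
-/
theorem exists_pow_independent (x : S.M n) (hx : ∀ c : D n, x ≠ S.C n c) :
    ∃ c : D n, ∀ (s : Finset ℕ) (a : ℕ → D n),
      ∑ i ∈ s, S.C n (a i) * (x - S.C n c) ^ i = 0 → ∀ i ∈ s, a i = 0 := by
  let j : S.M n →+* S.Ext ⊥ n := Algebra.TensorProduct.includeLeftRingHom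
  have hj : ∀ y, j y = y ⊗ₜ 1 := fun _ => rfl
  obtain ⟨c, hc⟩ := S.exists_ext_pow_independent ⊥ n (j x) fun c h => hx c
    (Algebra.TensorProduct.includeLeft_injective (S := RatFunc F) (A := S.M n)
      (algebraMap (RatFunc F) (LPow ⊥ (S.l n) (S.l_pos n))).injective h)
  refine ⟨c, fun s a h => hc s a ?_⟩
  have := congrArg j h
  rw [map_sum, map_zero] at this
  rw [← this]
  exact Finset.sum_congr rfl fun i _ => by rw [map_mul, map_pow, map_sub]; rfl

theorem isSkewField_ext [Algebra.IsAlgebraic (RatFunc F) L] : IsSkewField (S.Ext L n) := by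
  have : Algebra.IsAlgebraic (RatFunc F) (LPow L (S.l n) (S.l_pos n)) :=
    (LPow.equiv L (S.l n) (S.l_pos n)).isAlgebraic
  exact isSkewField_tensor

theorem isOuterGalois_ext [IsGalois (RatFunc F) L] :
    IsOuterGalois (Algebra.TensorProduct.includeLeftRingHom : S.M n →+* S.Ext L n) := by
  have : IsGalois (RatFunc F) (LPow L (S.l n) (S.l_pos n)) :=
    IsGalois.of_algEquiv (LPow.equiv L (S.l n) (S.l_pos n))
  exact isOuterGalois_tensor

/-- The action of the Galois group on the right factor, transported along `L ≃ L_{l n}`. -/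
theorem exists_galois_mulEquiv [IsGalois (RatFunc F) L] :
    ∃ ω : (L ≃ₐ[RatFunc F] L) ≃*
        extAut (Algebra.TensorProduct.includeLeftRingHom : S.M n →+* S.Ext L n),
      ∀ g x y, (ω g : RingAut (S.Ext L n)) (x ⊗ₜ toLPow L _ _ y) = x ⊗ₜ toLPow L _ _ (g y) := by
  have : IsGalois (RatFunc F) (LPow L (S.l n) (S.l_pos n)) :=
    IsGalois.of_algEquiv (LPow.equiv L (S.l n) (S.l_pos n))
  refine ⟨(LPow.equiv L (S.l n) (S.l_pos n)).autCongr.trans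
    (MulEquiv.ofBijective (tensorAut (RatFunc F) (S.M n) _) tensorAut_bijective), fun g x y => ?_⟩
  refine (tensorAut_tmul _ _ _).trans ?_
  change x ⊗ₜ LPow.equiv L (S.l n) (S.l_pos n) (g ((LPow.equiv L (S.l n) (S.l_pos n)).symm
    (LPow.equiv L (S.l n) (S.l_pos n) y))) = _
  rw [AlgEquiv.symm_apply_apply]
  rfl

/-- A nonzero element of the limit comes from a nonzero element of some level, and is already
invertible there. -/
theorem isSkewField_extLim [Algebra.IsAlgebraic (RatFunc F) L] : IsSkewField (S.ExtLim L) := by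
  have : ∀ n, Nontrivial (S.Ext L n) := fun n => (S.isSkewField_ext L n).1
  refine ⟨inferInstance, fun x hx => ?_⟩
  induction x using DirectLimit.induction with | _ n x
  change IsUnit (S.extOf L n x)
  refine IsUnit.map _ ((S.isSkewField_ext L n).2 x ?_)
  rintro rfl
  exact hx (map_zero (S.extOf L n))

end SkewSystem


/-! ### Algebraic elements and generated subfields. -/

section Regular

variable {R A B : Type*} [DivisionRing R] [Ring A] [Ring B]

theorem subset_fieldClosure (s : Set A) : s ⊆ fieldClosure s := fun _ hx =>
  Subring.mem_sInf.2 fun _ hT => hT.1 hx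

theorem fieldClosure_le {s : Set A} {T : Subring A} (hs : s ⊆ T)
    (hT : ∀ x ∈ T, ∀ y, x * y = 1 → y * x = 1 → y ∈ T) : fieldClosure s ≤ T :=
  sInf_le ⟨hs, hT⟩

/-- A criterion for an algebraic element to lie in the base: otherwise a translate of it has
independent powers. -/
theorem mem_range_of_isAlgebraicOver {f : R →+* A} (C : R →+* B) (j : B →+* A)
    (hj : Function.Injective j) (hf : ∀ r, j (C r) = f r) {x : B}
    (hx : IsAlgebraicOver f (j x))
    (hind : (∀ c, x ≠ C c) → ∃ c, ∀ (s : Finset ℕ) (a : ℕ → R),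
      ∑ i ∈ s, C (a i) * (x - C c) ^ i = 0 → ∀ i ∈ s, a i = 0) : j x ∈ f.range := by
  by_contra hne
  obtain ⟨c, hc⟩ := hind fun c hxc => hne ⟨c, by rw [hxc, hf]⟩
  obtain ⟨⟨b, hb⟩, -⟩ := hx
  let _ : Module R A := Module.compHom A f
  have hsmul : ∀ (r : R) (a : A), r • a = f r * a := fun _ _ => rfl
  have hmem : j x - f c ∈ fieldClosure (Set.range f ∪ {j x}) :=
    Subring.sub_mem _ (subset_fieldClosure _ (Or.inr rfl))
      (subset_fieldClosure _ (Or.inl ⟨c, rfl⟩))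
  have hli : LinearIndependent R fun i : ℕ => (j x - f c) ^ i := by
    rw [linearIndependent_iff']
    intro s a h
    refine hc s a (hj ?_)
    rw [map_sum, map_zero, ← h]
    exact Finset.sum_congr rfl fun i _ => by
      rw [map_mul, map_pow, map_sub, hf, hf, hsmul]
  -- All powers of the translate lie in the field generated by `j x`, which has a finite left
  -- spanning set; an infinite independent family cannot fit.
  have hfin : Finite ℕ := hli.finite_of_le_span_finite _ (b : Set A) (by
    rintro _ ⟨i, rfl⟩
    obtain ⟨a, ha⟩ := hb _ (Subring.pow_mem _ hmem i)
    simp only [SetLike.mem_coe]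
    rw [ha]
    exact Submodule.sum_mem _ fun e he =>
      Submodule.smul_mem _ (a e) (Submodule.subset_span he))
  exact not_finite ℕ

/-- The image of a skew field under a ring morphism is closed under inversion. -/
theorem mem_range_of_mul_eq_one (hB : IsSkewField B) (j : B →+* A) {x y : A} (hx : x ∈ j.range)
    (hxy : x * y = 1) : y ∈ j.range := by
  obtain ⟨b, rfl⟩ := hx
  rcases subsingleton_or_nontrivial A with _ | _
  · exact Subsingleton.elim (0 : A) y ▸ zero_mem _
  have hb : b ≠ 0 := by
    rintro rfl
    rw [map_zero, zero_mul] at hxy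
    exact zero_ne_one hxy
  obtain ⟨u, rfl⟩ := hB.2 b hb
  refine ⟨(u⁻¹ : Bˣ), ?_⟩
  calc j (u⁻¹ : Bˣ) = j (u⁻¹ : Bˣ) * (j u * y) := by rw [hxy, mul_one]
    _ = y := by rw [← mul_assoc, ← map_mul, Units.inv_mul, map_one, one_mul]

theorem injective_of_isSkewField [Nontrivial A] (hB : IsSkewField B) (j : B →+* A) :
    Function.Injective j := by
  rw [injective_iff_map_eq_zero]
  intro b hb
  by_contra hne
  exact ((hB.2 b hne).map j).ne_zero hb

end Regular

theorem SkewSystem.hom_ext {F : Type v} [Field F] {D : ℕ → Type u} [∀ n, DivisionRing (D n)]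
    {S : SkewSystem F D} {n : ℕ} {R : Type*} [DivisionRing R] {f g : S.M n →+* R}
    (hC : ∀ a, f (S.C n a) = g (S.C n a)) (hX : f (S.X n) = g (S.X n)) : f = g :=
  SkewFrac.hom_ext (ψ := S.ψ n) hC hX

/-! ### Conjugation by `t_n` and the fields `Ω_n`. -/

namespace TowerData

variable {F : Type v} {h : Type u} [Field F] [DivisionRing h] (T : TowerData F h)

theorem tt_eq_pow {i j : ℕ} (hij : i ≤ j) : T.tt i = T.tt j ^ (T.l j / T.l i) := by
  unfold tt
  rw [← map_pow, ← T.sys.of_trans i j hij]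
  exact congrArg _ (T.sys.transHom_X i j hij)

theorem tt_ne_zero (n : ℕ) : T.tt n ≠ 0 := by
  refine (map_ne_zero (T.sys.of n)).2 fun h => ?_
  have := SkewFrac.coeff_eq_zero (T.sys.ψ n) 1 one_pos {1} (fun _ => 1) (by
    rw [Finset.sum_singleton, map_one, one_mul, mul_one, pow_one]
    exact h) 1 (Finset.mem_singleton_self 1)
  exact one_ne_zero this

theorem exists_mem_lvl (n : ℕ) (x : h) : ∃ m, n ≤ m ∧ x ∈ T.lvl m :=
  ⟨max n (T.index x), le_max_left _ _, T.mono (le_max_right _ _) (T.mem_index x)⟩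

/-- At a level `m ≥ n` containing `x`, the element `t_n` is a power of `t_m`, which acts on that
level through a power of `σ_m`. -/
theorem exists_tt_mul_α (n : ℕ) (x : h) : ∃ y, T.tt n * T.α x = T.α y * T.tt n := by
  obtain ⟨m, hnm, hx⟩ := T.exists_mem_lvl n x
  refine ⟨((T.sys.ψ m ^ (T.l m / T.l n)) ⟨x, hx⟩ : T.lvl m), ?_⟩
  rw [T.α_eq hx, T.α_eq (Subtype.coe_prop _), T.tt_eq_pow hnm, tt, ← map_pow, ← map_mul, ← map_mul]
  exact congrArg _ (SkewFrac.X_pow_mul_C (T.sys.ψ m) _ _)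

theorem α_injective : Function.Injective T.α := T.α.injective

/-- Being the image of a scalar, this power is central in `H`; the finite order of conjugation by
`t_n` comes from here. -/
theorem tt_pow_l (n : ℕ) : T.tt n ^ T.l n = algebraMap (RatFunc F) T.H RatFunc.X := by
  rw [tt, ← map_pow, ← (T.sys.of n).commutes]
  exact congrArg _ (T.sys.algebraMap_X n).symm

theorem α_ι (c : F) : T.α (T.ι c) = algebraMap (RatFunc F) T.H (RatFunc.C c) := by
  rw [T.α_eq (T.base_le 0 (T.ι_mem c)), ← (T.sys.of 0).commutes]
  exact congrArg _ (T.sys.algebraMap_C 0 c).symm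

/-- Conjugation by `t_n`, as an endomorphism of `h`. -/
noncomputable def conj (n : ℕ) : h →+* h where
  toFun x := (T.exists_tt_mul_α n x).choose
  map_one' := T.α_injective (mul_right_cancel₀ (T.tt_ne_zero n) (by
    rw [← (T.exists_tt_mul_α n 1).choose_spec, map_one, one_mul, mul_one]))
  map_zero' := T.α_injective (mul_right_cancel₀ (T.tt_ne_zero n) (by
    rw [← (T.exists_tt_mul_α n 0).choose_spec, map_zero, zero_mul, mul_zero]))
  map_add' x y := T.α_injective (mul_right_cancel₀ (T.tt_ne_zero n) (by
    rw [← (T.exists_tt_mul_α n (x + y)).choose_spec, map_add, map_add, mul_add, add_mul,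
      ← (T.exists_tt_mul_α n x).choose_spec, ← (T.exists_tt_mul_α n y).choose_spec]))
  map_mul' x y := T.α_injective (mul_right_cancel₀ (T.tt_ne_zero n) (by
    rw [← (T.exists_tt_mul_α n (x * y)).choose_spec, map_mul, map_mul, mul_assoc (T.α _),
      ← (T.exists_tt_mul_α n y).choose_spec, ← mul_assoc, ← mul_assoc,
      ← (T.exists_tt_mul_α n x).choose_spec]))

theorem tt_mul_α_conj (n : ℕ) (x : h) : T.tt n * T.α x = T.α (T.conj n x) * T.tt n :=
  (T.exists_tt_mul_α n x).choose_spec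

/-- Values of `conj` are obtained by choice; this determines them by the commutation relation in
`H`. -/
theorem conj_eq_iff {n : ℕ} {x y : h} : T.conj n x = y ↔ T.tt n * T.α x = T.α y * T.tt n := by
  rw [tt_mul_α_conj, mul_left_inj' (T.tt_ne_zero n), T.α_injective.eq_iff]

theorem tt_pow_mul_α_conj (n q : ℕ) (x : h) :
    T.tt n ^ q * T.α x = T.α ((T.conj n)^[q] x) * T.tt n ^ q := by
  induction q generalizing x with
  | zero => rw [pow_zero, one_mul, mul_one]; rfl
  | succ q ih =>
    rw [pow_succ, mul_assoc, tt_mul_α_conj, ← mul_assoc, ih, mul_assoc, Function.iterate_succ_apply]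

theorem conj_iterate_l (n : ℕ) (x : h) : (T.conj n)^[T.l n] x = x := by
  have h1 := T.tt_pow_mul_α_conj n (T.l n) x
  have h2 := T.tt_pow_l n
  rw [h2, Algebra.commutes, ← h2] at h1
  exact (T.α_injective (mul_right_cancel₀ (pow_ne_zero _ (T.tt_ne_zero n)) h1)).symm

/-- The automorphism of `h` given by conjugation by `t_n`. -/
noncomputable def ψ (n : ℕ) : RingAut h :=
  RingEquiv.ofBijective (T.conj n) ⟨(T.conj n).injective, fun x =>
    -- Since the `l_n`-th iterate is the identity and `l_n > 0`, the iterate of exponent `l_n - 1`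
    -- supplies preimages.
    ⟨(T.conj n)^[T.l n - 1] x, by
      have h1 := Function.iterate_succ_apply' (T.conj n) (T.l n - 1) x
      rw [Nat.succ_eq_add_one, Nat.sub_add_cancel (T.l_pos n), conj_iterate_l] at h1
      exact h1.symm⟩⟩

theorem ψ_pow_apply (n q : ℕ) (x : h) : (T.ψ n ^ q) x = (T.conj n)^[q] x := by
  induction q generalizing x with
  | zero => rfl
  | succ q ih =>
    rw [pow_succ, Function.iterate_succ_apply, ← ih]
    rfl

/-- Each condition reflects a relation in `H`: scalars are central, `t_n ^ l_n` is central, and `t_i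
= t_j ^ (l_j / l_i)`. -/
theorem isCompatible_ψ : T.IsCompatible T.ψ := by
  refine ⟨fun n c => ?_, fun n => ?_, fun i j hij => ?_⟩
  · refine T.conj_eq_iff.2 ?_
    rw [α_ι, Algebra.commutes]
  · ext x
    rw [ψ_pow_apply, conj_iterate_l]
    rfl
  · ext x
    refine T.conj_eq_iff.2 ?_
    rw [ψ_pow_apply, T.tt_eq_pow hij, tt_pow_mul_α_conj]

/-- The powers of `t_n` are left linearly independent over `h`. -/
theorem α_coeff_eq_zero (n : ℕ) (s : Finset ℕ) (c : ℕ → h)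
    (h0 : ∑ i ∈ s, T.α (c i) * T.tt n ^ i = 0) : ∀ i ∈ s, c i = 0 := by
  classical
  -- A single level above `n` contains all the coefficients. There `t_n` is a positive power of the
  -- indeterminate, so the relation is one between distinct powers of it.
  let m := max n (s.sup fun i => T.index (c i))
  have hnm : n ≤ m := le_max_left _ _
  have hmem : ∀ i ∈ s, c i ∈ T.lvl m := fun i hi =>
    T.mono ((Finset.le_sup (f := fun i => T.index (c i)) hi).trans (le_max_right _ _))
      (T.mem_index (c i))
  -- The value `0` only makes `c'` total; it is never taken for indices in `s`.
  let c' : ℕ → T.lvl m := fun i => if hi : c i ∈ T.lvl m then ⟨c i, hi⟩ else 0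
  have hc' : ∀ i (hi : i ∈ s), c' i = ⟨c i, hmem i hi⟩ := fun i hi => dif_pos (hmem i hi)
  have hq : 0 < T.l m / T.l n := Nat.div_pos (Nat.le_of_dvd (T.l_pos m) (T.l_dvd n m hnm)) (T.l_pos n)
  have key : T.sys.of m (∑ i ∈ s, T.sys.C m (c' i) * T.sys.X m ^ (T.l m / T.l n * i)) = 0 := by
    rw [← h0, map_sum]
    refine Finset.sum_congr rfl fun i hi => ?_
    rw [map_mul, map_pow, T.α_eq (hmem i hi), T.tt_eq_pow hnm, ← pow_mul, hc' i hi]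
    rfl
  intro i hi
  have h1 := SkewFrac.coeff_eq_zero (T.sys.ψ m) _ hq s c' ((map_eq_zero (T.sys.of m)).1 key) i hi
  rw [hc' i hi] at h1
  exact congrArg Subtype.val h1

theorem α_mem_Ω (n : ℕ) (x : h) : T.α x ∈ T.Ω n := Subfield.subset_closure (Or.inl ⟨x, rfl⟩)

theorem tt_mem_Ω (n : ℕ) : T.tt n ∈ T.Ω n := Subfield.subset_closure (Or.inr ⟨_, rfl⟩)

/-- The embedding `h → Ω n`. -/
noncomputable def αΩ (n : ℕ) : h →+* T.Ω n := T.α.codRestrict (T.Ω n) (T.α_mem_Ω n)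

/-- The element `t_n` of `Ω n`. -/
noncomputable def ttΩ (n : ℕ) : T.Ω n := ⟨T.tt n, T.tt_mem_Ω n⟩

theorem ttΩ_mul_αΩ (n : ℕ) (x : h) : T.ttΩ n * T.αΩ n x = T.αΩ n (T.ψ n x) * T.ttΩ n :=
  Subtype.ext (T.tt_mul_α_conj n x)

theorem evalPoly_αΩ_injective (n : ℕ) :
    Function.Injective (SkewFrac.evalPoly (T.αΩ n) (T.ttΩ n) (T.ttΩ_mul_αΩ n)) := by
  rw [injective_iff_map_eq_zero]
  intro p hp
  rw [SkewFrac.evalPoly_apply] at hp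
  refine coeff_ext fun m => ?_
  by_contra hm
  have h0 := congrArg (T.Ω n).subtype hp
  rw [map_sum, map_zero] at h0
  have h1 := T.α_coeff_eq_zero n p.support (fun i => (Twist.of (T.ψ n)).symm (p.coeff i)) (by
    rw [← h0]
    exact Finset.sum_congr rfl fun i _ => by rw [map_mul, map_pow]; rfl) m
    (SkewPolynomial.mem_support_iff.2 hm)
  exact hm ((map_eq_zero_iff _ (Twist.of (T.ψ n)).symm.injective).1 h1)

/-- The morphism `h(t, ψ n) → Ω n`, `t ↦ t_n`. -/
noncomputable def toΩ (n : ℕ) : T.isCompatible_ψ.sys.M n →+* T.Ω n :=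
  SkewFrac.lift (ψ := T.ψ n) (T.αΩ n) (T.ttΩ n) (T.ttΩ_mul_αΩ n) (T.evalPoly_αΩ_injective n)

theorem toΩ_C (n : ℕ) (x : h) : T.toΩ n (T.isCompatible_ψ.sys.C n x) = T.αΩ n x :=
  SkewFrac.lift_C _ _ _ _ _

theorem toΩ_X (n : ℕ) : T.toΩ n (T.isCompatible_ψ.sys.X n) = T.ttΩ n :=
  SkewFrac.lift_X _ _ _ _

theorem toΩ_algebraMap (n : ℕ) (r : RatFunc F) :
    T.toΩ n (algebraMap (RatFunc F) _ r) = algebraMap (RatFunc F) (T.Ω n) r := by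
  have h1 : (T.toΩ n).comp (algebraMap (RatFunc F) (T.isCompatible_ψ.sys.M n)) =
      algebraMap (RatFunc F) (T.Ω n) := by
    refine ratFunc_hom_ext (fun c => ?_) ?_
    · rw [RingHom.comp_apply, SkewSystem.algebraMap_C, toΩ_C]
      exact Subtype.ext (T.α_ι c)
    · rw [RingHom.comp_apply, SkewSystem.algebraMap_X, map_pow, toΩ_X]
      exact Subtype.ext (T.tt_pow_l n)
  exact RingHom.congr_fun h1 r

/-- `T.ψ n` extends `σ_n ^ a_n`. The exponent `1` is the form that `SkewFrac.map` asks for when `t ↦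
t`. -/
theorem ψ_coe (n : ℕ) (x : T.lvl n) :
    (T.lvl n).subtype (T.sys.ψ n x) = (T.ψ n ^ 1) ((T.lvl n).subtype x) := by
  rw [pow_one]
  refine (T.conj_eq_iff.2 ?_).symm
  change T.tt n * T.α x = T.α (T.sys.ψ n x : T.lvl n) * T.tt n
  rw [T.α_eq x.2, T.α_eq (Subtype.coe_prop _), tt, ← map_mul, ← map_mul]
  exact congrArg _ (SkewFrac.X_mul_C (T.sys.ψ n) _)

/-- Enlarging coefficients from `lvl n` to `h` factors the canonical map to `H` through `h(t, ψ_n)`;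
it suffices to compare on coefficients and on `t`. -/
theorem of_eq_toΩ (n : ℕ) (x : T.sys.M n) : ∃ y, T.sys.of n x = T.toΩ n y := by
  let g : T.sys.M n →+* T.isCompatible_ψ.sys.M n :=
    SkewFrac.map (ψ := T.sys.ψ n) (ψ' := T.ψ n) (T.lvl n).subtype 1 one_pos (T.ψ_coe n)
  refine ⟨g x, ?_⟩
  have h1 : (T.sys.of n : T.sys.M n →+* T.H) = ((T.Ω n).subtype.comp (T.toΩ n)).comp g := by
    refine SkewFrac.hom_ext (ψ := T.sys.ψ n) (fun a => ?_) ?_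
    · have : g (T.sys.C n a) = T.isCompatible_ψ.sys.C n a := SkewFrac.map_C _ _ _ _ _
      change T.sys.of n (T.sys.C n a) = T.toΩ n (g (T.sys.C n a))
      rw [this, toΩ_C]
      exact (T.α_eq a.2).symm
    · have : g (T.sys.X n) = T.isCompatible_ψ.sys.X n ^ 1 := SkewFrac.map_X _ _ _ _
      change T.sys.of n (T.sys.X n) = T.toΩ n (g (T.sys.X n))
      rw [this, pow_one, toΩ_X]
      rfl
  exact RingHom.congr_fun h1 x

/-- The image is a subfield containing `h` and the image of `lvl n (t, σ n ^ a n)`, which generate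
`Ω n`. -/
theorem toΩ_bijective (n : ℕ) : Function.Bijective (T.toΩ n) := by
  refine ⟨(T.toΩ n).injective, fun x => ?_⟩
  have hle : T.Ω n ≤ ((T.Ω n).subtype.comp (T.toΩ n)).fieldRange := by
    refine Subfield.closure_le.2 ?_
    rintro _ (⟨y, rfl⟩ | ⟨y, rfl⟩)
    · exact ⟨T.isCompatible_ψ.sys.C n y, congrArg Subtype.val (T.toΩ_C n y)⟩
    · obtain ⟨z, hz⟩ := T.of_eq_toΩ n y
      exact ⟨z, hz.symm⟩
  obtain ⟨y, hy⟩ := hle x.2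
  exact ⟨y, Subtype.ext hy⟩

/-- The isomorphism `h(t, ψ n) ≃ Ω n`. -/
noncomputable def equivΩ (n : ℕ) : T.isCompatible_ψ.sys.M n ≃ₐ[RatFunc F] T.Ω n :=
  AlgEquiv.ofBijective { T.toΩ n with commutes' := T.toΩ_algebraMap n } (T.toΩ_bijective n)

theorem coe_αΩ (n : ℕ) (x : h) : (T.αΩ n x : T.H) = T.α x := rfl

theorem coe_ttΩ (n : ℕ) : (T.ttΩ n : T.H) = T.tt n := rfl

theorem toΩ_trans_C (i j : ℕ) (hij : i ≤ j) (a : h) :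
    (T.toΩ j (T.isCompatible_ψ.sys.transHom i j hij (T.isCompatible_ψ.sys.C i a)) : T.H) =
      T.toΩ i (T.isCompatible_ψ.sys.C i a) := by
  have h1 : T.isCompatible_ψ.sys.φ i j hij a = a := rfl
  rw [SkewSystem.transHom_C, h1, toΩ_C, toΩ_C, coe_αΩ, coe_αΩ]

theorem toΩ_trans_X (i j : ℕ) (hij : i ≤ j) :
    (T.toΩ j (T.isCompatible_ψ.sys.transHom i j hij (T.isCompatible_ψ.sys.X i)) : T.H) =
      T.toΩ i (T.isCompatible_ψ.sys.X i) := by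
  rw [SkewSystem.transHom_X, map_pow, toΩ_X, toΩ_X, coe_ttΩ, T.tt_eq_pow hij, SubmonoidClass.coe_pow,
    coe_ttΩ]

theorem toΩ_transHom (i j : ℕ) (hij : i ≤ j) (x : T.isCompatible_ψ.sys.M i) :
    (T.toΩ j (T.isCompatible_ψ.sys.transHom i j hij x) : T.H) = T.toΩ i x := by
  have h1 : ((T.Ω j).subtype.comp (T.toΩ j)).comp (T.isCompatible_ψ.sys.transHom i j hij) =
      (T.Ω i).subtype.comp (T.toΩ i) :=
    SkewSystem.hom_ext (T.toΩ_trans_C i j hij) (T.toΩ_trans_X i j hij)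
  exact RingHom.congr_fun h1 x

theorem toΩ_trans (i j : ℕ) (hij : i ≤ j) (x : T.isCompatible_ψ.sys.M i) :
    (T.toΩ j (T.isCompatible_ψ.sys.trans i j hij x) : T.H) = T.toΩ i x :=
  T.toΩ_transHom i j hij x

/-- The morphism `lim h(t, ψ n) → H`. -/
noncomputable def limHom : T.isCompatible_ψ.sys.Lim →+* T.H :=
  DirectLimit.Ring.lift _ T.isCompatible_ψ.sys.trans T.H
    (fun n => (T.Ω n).subtype.comp (T.toΩ n)) (fun i j hij x => T.toΩ_trans i j hij x)

theorem limHom_of (n : ℕ) (x : T.isCompatible_ψ.sys.M n) :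
    T.limHom (T.isCompatible_ψ.sys.of n x) = T.toΩ n x :=
  DirectLimit.Ring.lift_of _ _ _ _ _

theorem exists_toΩ (x : T.H) : ∃ n y, (T.toΩ n y : T.H) = x := by
  induction x using DirectLimit.induction with | _ n x
  obtain ⟨y, hy⟩ := T.of_eq_toΩ n x
  exact ⟨n, y, hy.symm⟩

theorem limHom_bijective : Function.Bijective T.limHom := by
  refine ⟨T.limHom.injective, fun x => ?_⟩
  obtain ⟨n, y, rfl⟩ := T.exists_toΩ x
  exact ⟨T.isCompatible_ψ.sys.of n y, T.limHom_of n y⟩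

/-- An element of `H` lies in some `Ω n`, identified with `h(t, ψ n)`. The coefficient field is now
all of `h`, so the independence criterion applies directly. -/
theorem isRegularExt_α : IsRegularExt T.α := by
  intro x hx
  obtain ⟨n, y, rfl⟩ := T.exists_toΩ x
  exact mem_range_of_isAlgebraicOver (T.isCompatible_ψ.sys.C n)
    ((T.Ω n).subtype.comp (T.toΩ n)) (RingHom.injective _)
    (fun r => congrArg Subtype.val (T.toΩ_C n r)) hx
    (T.isCompatible_ψ.sys.exists_pow_independent n y)

/-! ### The fields `h(t, ψ_n) ⊗ L_{l_n}` inside `H_G`. -/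

variable (L : IntermediateField (RatFunc F) F⸨X⸩)

/-- The morphism `h(t, ψ n) ⊗ L_{l n} → H_G`. -/
noncomputable def extHom (n : ℕ) : T.isCompatible_ψ.sys.Ext L n →ₐ[RatFunc F] T.HG L :=
  (T.Ωext L n).comp (Algebra.TensorProduct.map
    (T.equivΩ n : T.isCompatible_ψ.sys.M n →ₐ[RatFunc F] T.Ω n) (AlgHom.id _ _))

theorem extHom_tmul (n : ℕ) (x : T.isCompatible_ψ.sys.M n) (y : LPow L (T.l n) (T.l_pos n)) :
    T.extHom L n (x ⊗ₜ y) = T.sys.limToExtLim L (T.toΩ n x : T.H) * T.sys.LToExtLim L n y := by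
  change T.Ωext L n (Algebra.TensorProduct.map _ _ (x ⊗ₜ y)) = _
  rw [Algebra.TensorProduct.map_tmul]
  exact Algebra.TensorProduct.lift_tmul _ _ _ _ _

theorem extHom_C (n : ℕ) (x : h) :
    T.extHom L n (T.isCompatible_ψ.sys.C n x ⊗ₜ 1) = T.αG L x := by
  rw [extHom_tmul, map_one, mul_one, toΩ_C]
  rfl

/-- The first tensor factor passes through `h(t, ψ_n)`. Hence `H_G` is the union of the images of
the maps `extHom`. -/
theorem extOf_mem_range (n : ℕ) (x : T.sys.Ext L n) :
    T.sys.extOf L n x ∈ (T.extHom L n).toRingHom.range := by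
  induction x using TensorProduct.induction_on with
  | zero => rw [map_zero]; exact zero_mem _
  | add x y hx hy => rw [map_add]; exact add_mem hx hy
  | tmul x y =>
    obtain ⟨z, hz⟩ := T.of_eq_toΩ n x
    refine ⟨z ⊗ₜ y, (T.extHom_tmul L n z y).trans ?_⟩
    rw [← hz, SkewSystem.limToExtLim_of]
    change T.sys.extOf L n (x ⊗ₜ 1) * T.sys.extOf L n (1 ⊗ₜ y) = _
    rw [← map_mul, Algebra.TensorProduct.tmul_mul_tmul, mul_one, one_mul]

theorem limToExtLim_mem_fieldClosure (n : ℕ) {x : T.H} (hx : x ∈ T.Ω n) :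
    T.sys.limToExtLim L x ∈
      fieldClosure (Set.range (T.αG L) ∪ Set.range (T.sys.extOf L n)) := by
  refine Subring.mem_sInf.2 fun U hU => ?_
  -- The preimage in `H` of an inverse-closed subring of `H_G` is a subfield, so the universal
  -- property of `Ω n` applies to it.
  let V : Subfield T.H :=
    { U.comap (T.sys.limToExtLim L : T.H →+* T.HG L) with
      inv_mem' := fun y hy => by
        by_cases hy0 : y = 0
        · rw [hy0, inv_zero]
          exact (U.comap (T.sys.limToExtLim L : T.H →+* T.HG L)).zero_mem
        · refine hU.2 _ hy _ ?_ ?_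
          · exact (map_mul (T.sys.limToExtLim L) _ _).symm.trans
              (by rw [mul_inv_cancel₀ hy0, map_one])
          · exact (map_mul (T.sys.limToExtLim L) _ _).symm.trans
              (by rw [inv_mul_cancel₀ hy0, map_one]) }
  have hle : T.Ω n ≤ V := by
    refine Subfield.closure_le.2 ?_
    rintro _ (⟨y, rfl⟩ | ⟨y, rfl⟩)
    · exact hU.1 (Or.inl ⟨y, rfl⟩)
    · exact hU.1 (Or.inr ⟨y ⊗ₜ 1, rfl⟩)
  exact hle hx

variable [Algebra.IsAlgebraic (RatFunc F) L]

/-- The source is a skew field and the target is nontrivial. -/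
theorem extHom_injective (n : ℕ) : Function.Injective (T.extHom L n) :=
  have : Nontrivial (T.HG L) := (T.sys.isSkewField_extLim L).1
  injective_of_isSkewField (T.isCompatible_ψ.sys.isSkewField_ext L n)
    (T.extHom L n).toRingHom

/-- The image of a skew field is inverse-closed, so it contains the compositum once it contains the
generators; conversely each pure tensor maps to a product of two elements of the compositum. -/
theorem range_extHom (n : ℕ) : Set.range (T.extHom L n) =
    fieldClosure (Set.range (T.αG L) ∪ Set.range (T.sys.extOf L n)) := by
  refine Set.Subset.antisymm ?_ ?_
  · rintro _ ⟨x, rfl⟩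
    induction x using TensorProduct.induction_on with
    | zero => rw [map_zero]; exact zero_mem _
    | add x y hx hy => rw [map_add]; exact add_mem hx hy
    | tmul x y =>
      rw [extHom_tmul]
      exact Subring.mul_mem _ (T.limToExtLim_mem_fieldClosure L n (T.toΩ n x).2)
        (subset_fieldClosure _ (Or.inr ⟨1 ⊗ₜ y, rfl⟩))
  · refine fieldClosure_le (T := (T.extHom L n).toRingHom.range) ?_ fun x hx y hxy _ =>
      mem_range_of_mul_eq_one (T.isCompatible_ψ.sys.isSkewField_ext L n) _ hx hxy
    rintro _ (⟨y, rfl⟩ | ⟨y, rfl⟩)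
    · exact ⟨_, T.extHom_C L n y⟩
    · exact T.extOf_mem_range L n y

/-- As for `H`, with `h(t, ψ_n) ⊗ L_{l_n}` in place of `h(t, ψ_n)`. -/
theorem isRegularExt_αG : IsRegularExt (T.αG L) := by
  intro x hx
  induction x using DirectLimit.induction with | _ n x
  obtain ⟨y, hy⟩ := T.extOf_mem_range L n x
  change IsAlgebraicOver _ (T.sys.extOf L n x) at hx
  change T.sys.extOf L n x ∈ _
  rw [← hy] at hx ⊢
  exact mem_range_of_isAlgebraicOver
    ((Algebra.TensorProduct.includeLeftRingHom).comp (T.isCompatible_ψ.sys.C n))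
    (T.extHom L n).toRingHom (T.extHom_injective L n) (T.extHom_C L n) hx
    (T.isCompatible_ψ.sys.exists_ext_pow_independent L n y)

end TowerData

end SkewTower

theorem proposition5 {F : Type v} {h : Type u} [Field F] [DivisionRing h]
    (L : IntermediateField (RatFunc F) F⸨X⸩) [IsGalois (RatFunc F) L]
    (T : SkewTower.TowerData F h) :
    ∃ (ψ : ℕ → RingAut h) (hψ : T.IsCompatible ψ)
      (f : ∀ n, hψ.sys.M n ≃ₐ[RatFunc F] T.Ω n),
      (∀ n, IsOfFinOrder (ψ n)) ∧
      (∀ n x, (f n (hψ.sys.C n x) : T.H) = T.α x) ∧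
      (∀ n, (f n (hψ.sys.X n) : T.H) = T.tt n) ∧
      SkewTower.IsSkewField (T.HG L) ∧
      (∀ n, ∃ g : hψ.sys.Ext L n →ₐ[RatFunc F] T.HG L,
        g = (T.Ωext L n).comp
          (Algebra.TensorProduct.map (f n : hψ.sys.M n →ₐ[RatFunc F] T.Ω n) (AlgHom.id _ _)) ∧
        Function.Injective g ∧
        Set.range g =
          SkewTower.fieldClosure (Set.range (T.αG L) ∪ Set.range (T.sys.extOf L n)) ∧
        ∀ x, g (hψ.sys.C n x ⊗ₜ 1) = T.αG L x) ∧
      (∀ n, SkewTower.IsSkewField (hψ.sys.Ext L n) ∧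
        SkewTower.IsOuterGalois
          (Algebra.TensorProduct.includeLeftRingHom : hψ.sys.M n →+* hψ.sys.Ext L n) ∧
        ∃ ω : (L ≃ₐ[RatFunc F] L) ≃* SkewTower.extAut
            (Algebra.TensorProduct.includeLeftRingHom : hψ.sys.M n →+* hψ.sys.Ext L n),
          ∀ g x y, (ω g : RingAut (hψ.sys.Ext L n)) (x ⊗ₜ SkewTower.toLPow L _ _ y) =
            x ⊗ₜ SkewTower.toLPow L _ _ (g y)) ∧
      SkewTower.IsRegularExt T.α ∧
      SkewTower.IsRegularExt (T.αG L) ∧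
      ∃ Φ : hψ.sys.Lim ≃+* T.H,
        (∀ n x, Φ (hψ.sys.of n x) = f n x) ∧
        ∀ n x, Φ (hψ.sys.of n (hψ.sys.C n x)) = T.α x := by
  have hα : ∀ n x, (T.equivΩ n (T.isCompatible_ψ.sys.C n x) : T.H) = T.α x := fun n x =>
    congrArg Subtype.val (T.toΩ_C n x)
  refine ⟨T.ψ, T.isCompatible_ψ, T.equivΩ, fun n => ?_, hα,
    fun n => congrArg Subtype.val (T.toΩ_X n), T.sys.isSkewField_extLim L,
    fun n => ⟨T.extHom L n, rfl, T.extHom_injective L n, T.range_extHom L n, T.extHom_C L n⟩,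
    fun n => ⟨T.isCompatible_ψ.sys.isSkewField_ext L n, T.isCompatible_ψ.sys.isOuterGalois_ext L n,
      T.isCompatible_ψ.sys.exists_galois_mulEquiv L n⟩,
    T.isRegularExt_α, T.isRegularExt_αG L,
    RingEquiv.ofBijective T.limHom T.limHom_bijective, T.limHom_of,
    fun n x => (T.limHom_of n _).trans (hα n x)⟩
  exact isOfFinOrder_iff_pow_eq_one.2 ⟨T.l n, T.l_pos n, T.isCompatible_ψ.2.1 n⟩
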